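/- Let $k$ be a field and let $A$ be a Poisson algebra over $k$, i.e. a commutative $k$-algebra with a $k$-bilinear Lie bracket $\{\cdot,\cdot\}$ satisfying $\{a,bc\}=\{a,b\}c+b\{a,c\}$. Let $A^e$ be its universal enveloping algebra: the associative unital $k$-algebra generated by two copies $m_A=\{m_a\}$, $h_A=\{h_a\}$ of the vector space $A$ (so that $a\mapsto m_a$ and $a\mapsto h_a$ are $k$-linear) subject to $$m_{xy}=m_xm_y,\quad h_{\{x,y\}}=h_xh_y-h_yh_x,\quad h_{xy}=m_yh_x+m_xh_y,\quad m_{\{x,y\}}=h_xm_y-m_yh_x,\quad m_1=1 \qquad (x,y\in A).$$ Regard $A^e$ as a left $A$-module via $a\cdot u=m_au$, and let $\Omega_A$ be the $A$-module of Kähler differentials of $A$ over $k$, mapped $A$-linearly to $A^e$ by $a\,dx\mapsto m_ah_x$. For $n\ge 0$ let $F_n\subseteq A^e$ be the left $A$-submodule generated by all products of at most $n$ elements of the image of $\Omega_A$, and let $F_{-1}=0$. Then $F_iF_j\subseteq F_{i+j}$, and $\operatorname{gr}_F A^e=\bigoplus_{n\ge 0}F_n/F_{n-1}$ is an $A$-algebra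 via $a\mapsto [m_a]\in F_0$. If $\Omega_A$ is a projective $A$-module, then there is an isomorphism of $A$-algebras $$S_A(\Omega_A)\;\cong\;\operatorname{gr}_F A^e,$$ where $S_A(\Omega_A)$ is the symmetric $A$-algebra on $\Omega_A$; it can be chosen to send $dx$ to the class of $h_x$ in $F_1/F_0$ for every $x\in A$. -/

import Mathlib

open scoped DirectSum

universe u v

/-- A Poisson algebra over a field `k`: a commutative `k`-algebra `A` with a `k`-bilinear Lie bracket
`{·,·}` which is a derivation in its second argument.  (The bracket is not Mathlib's `⁅·,·⁆`, which
on a ring already denotes the commutator.) -/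
class PoissonAlgebra (k : Type u) (A : Type v) [Field k] [CommRing A] [Algebra k A] where
  /-- The Poisson bracket. -/
  bracket : A →ₗ[k] A →ₗ[k] A
  bracket_self : ∀ a, bracket a a = 0
  jacobi : ∀ a b c, bracket a (bracket b c) + bracket b (bracket c a) + bracket c (bracket a b) = 0
  leibniz : ∀ a b c, bracket a (b * c) = bracket a b * c + b * bracket a c

namespace PoissonAlgebra

section Enveloping

variable (k : Type u) (A : Type v) [Field k] [CommRing A] [Algebra k A] [PoissonAlgebra k A]

/-- The generator `m_a`, where the two copies `m_A`, `h_A` of the vector space `A` are the two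
summands of `A × A`. -/
noncomputable def genM (a : A) : TensorAlgebra k (A × A) := TensorAlgebra.ι k (a, 0)

/-- The generator `h_a`. -/
noncomputable def genH (a : A) : TensorAlgebra k (A × A) := TensorAlgebra.ι k (0, a)

/-- The defining relations of the enveloping algebra `A^e`. -/
inductive EnvRel : TensorAlgebra k (A × A) → TensorAlgebra k (A × A) → Prop
  | m_mul (x y : A) : EnvRel (genM k A (x * y)) (genM k A x * genM k A y)
  | h_bracket (x y : A) : EnvRel (genH k A (bracket (k := k) x y))
      (genH k A x * genH k A y - genH k A y * genH k A x)
  | h_mul (x y : A) : EnvRel (genH k A (x * y))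
      (genM k A y * genH k A x + genM k A x * genH k A y)
  | m_bracket (x y : A) : EnvRel (genM k A (bracket (k := k) x y))
      (genH k A x * genM k A y - genM k A y * genH k A x)
  | m_one : EnvRel (genM k A 1) 1

/-- The universal enveloping algebra `A^e` of the Poisson algebra `A`: the associative unital
`k`-algebra generated by the vector spaces `m_A` and `h_A` subject to `EnvRel`. -/
def Env : Type (max u v) := RingQuot (EnvRel k A)

noncomputable instance : Ring (Env k A) := inferInstanceAs (Ring (RingQuot (EnvRel k A)))

noncomputable instance : Algebra k (Env k A) :=
  inferInstanceAs (Algebra k (RingQuot (EnvRel k A)))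

/-- The quotient map onto `A^e`. -/
noncomputable def Env.mk : TensorAlgebra k (A × A) →ₐ[k] Env k A :=
  RingQuot.mkAlgHom k (EnvRel k A)

variable {k A} in
theorem Env.mk_rel {x y : TensorAlgebra k (A × A)} (h : EnvRel k A x y) :
    Env.mk k A x = Env.mk k A y :=
  RingQuot.mkAlgHom_rel k h

/-- The structure map `m : A → A^e`, an algebra map. -/
noncomputable def Env.m : A →ₐ[k] Env k A :=
  AlgHom.ofLinearMap
    ((Env.mk k A).toLinearMap ∘ₗ TensorAlgebra.ι k ∘ₗ LinearMap.inl k A A)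
    ((Env.mk_rel EnvRel.m_one).trans (map_one _))
    (fun x y => (Env.mk_rel (EnvRel.m_mul x y)).trans (map_mul _ _ _))

/-- The structure map `h : A → A^e`, a `k`-linear map. -/
noncomputable def Env.h : A →ₗ[k] Env k A :=
  (Env.mk k A).toLinearMap ∘ₗ TensorAlgebra.ι k ∘ₗ LinearMap.inr k A A

theorem Env.h_mul (x y : A) :
    Env.h k A (x * y) = Env.m k A y * Env.h k A x + Env.m k A x * Env.h k A y :=
  (Env.mk_rel (EnvRel.h_mul x y)).trans (by rw [map_add, map_mul, map_mul]; rfl)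

theorem Env.m_bracket (x y : A) :
    Env.m k A (bracket (k := k) x y) = Env.h k A x * Env.m k A y - Env.m k A y * Env.h k A x :=
  (Env.mk_rel (EnvRel.m_bracket x y)).trans (by rw [map_sub, map_mul, map_mul]; rfl)

/-- `A^e` is a left `A`-module by `a • u = m_a u`. -/
noncomputable instance : Module A (Env k A) := Module.compHom (Env k A) (Env.m k A).toRingHom

theorem Env.smul_eq (a : A) (u : Env k A) : a • u = Env.m k A a * u := rfl

instance : IsScalarTower k A (Env k A) where
  smul_assoc c a u := by
    rw [Env.smul_eq, Env.smul_eq, map_smul, smul_mul_assoc]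

/-- The derivation `A → A^e`, `x ↦ h_x`. -/
noncomputable def Env.hDer : Derivation k A (Env k A) :=
  Derivation.mk' (Env.h k A) (fun x y => by
    rw [Env.h_mul, Env.smul_eq, Env.smul_eq, add_comm])

/-- The `A`-linear map `Ω_A → A^e`, `a dx ↦ m_a h_x`. -/
noncomputable def Env.θ : Ω[A⁄k] →ₗ[A] Env k A := (Env.hDer k A).liftKaehlerDifferential

theorem Env.θ_D (x : A) : Env.θ k A (KaehlerDifferential.D k A x) = Env.h k A x :=
  (Env.hDer k A).liftKaehlerDifferential_comp_D x

/-- Rinehart's filtration: `F_n` is the left `A`-submodule of `A^e` generated by the products of at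
most `n` elements of the image of `Ω_A`. -/
noncomputable def Env.F (n : ℕ) : Submodule A (Env k A) :=
  Submodule.span A {u | ∃ l : List (Ω[A⁄k]), l.length ≤ n ∧ (l.map (Env.θ k A)).prod = u}

/-- `F_{n-1}`, with `F_{-1} = 0`. -/
noncomputable def Env.Fpred : ℕ → Submodule A (Env k A)
  | 0 => ⊥
  | n + 1 => Env.F k A n

namespace Env

variable {k A}

theorem F_mono {i j : ℕ} (h : i ≤ j) : F k A i ≤ F k A j :=
  Submodule.span_mono (fun _ ⟨l, hl, e⟩ => ⟨l, hl.trans h, e⟩)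

theorem Fpred_le (n : ℕ) : Fpred k A n ≤ F k A n := by
  cases n with
  | zero => exact bot_le
  | succ n => exact F_mono (Nat.le_succ n)

theorem Fpred_mono {i j : ℕ} (h : i ≤ j) : Fpred k A i ≤ Fpred k A j := by
  cases i with
  | zero => exact bot_le
  | succ i =>
    cases j with
    | zero => omega
    | succ j => exact F_mono (by omega)

theorem prod_mem_F (l : List (Ω[A⁄k])) : (l.map (θ k A)).prod ∈ F k A l.length :=
  Submodule.subset_span ⟨l, le_rfl, rfl⟩

theorem one_mem_F : (1 : Env k A) ∈ F k A 0 := prod_mem_F []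

theorem m_mem_F (a : A) : m k A a ∈ F k A 0 := by
  have := (F k A 0).smul_mem a one_mem_F
  rwa [smul_eq, mul_one] at this

theorem θ_mem_F (ω : Ω[A⁄k]) : θ k A ω ∈ F k A 1 := by
  simpa using prod_mem_F [ω]

theorem h_mem_F (x : A) : h k A x ∈ F k A 1 := by
  rw [← θ_D]; exact θ_mem_F _

/-- Commuting an element of `Ω_A` with `m_a` gives an element of `m_A`. -/
theorem θ_comm (ω : Ω[A⁄k]) (a : A) :
    ∃ b : A, θ k A ω * m k A a = m k A a * θ k A ω + m k A b := by
  have hω : ω ∈ Submodule.span A (Set.range (KaehlerDifferential.D k A)) := by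
    rw [KaehlerDifferential.span_range_derivation]; trivial
  induction hω using Submodule.span_induction with
  | mem ω h =>
    obtain ⟨x, rfl⟩ := h
    exact ⟨bracket (k := k) x a, by rw [θ_D, m_bracket]; abel⟩
  | zero => exact ⟨0, by simp⟩
  | add x y _ _ hx hy =>
    obtain ⟨b, hb⟩ := hx
    obtain ⟨c, hc⟩ := hy
    exact ⟨b + c, by rw [map_add, add_mul, hb, hc, mul_add, map_add]; abel⟩
  | smul c x _ hx =>
    obtain ⟨b, hb⟩ := hx
    refine ⟨c * b, ?_⟩
    rw [map_smul, smul_eq, mul_assoc, hb, mul_add, ← mul_assoc, ← mul_assoc, ← map_mul, ← map_mul,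
      ← map_mul, mul_comm c a]

theorem θ_mul_mem_F (ω : Ω[A⁄k]) {n : ℕ} {u : Env k A} (hu : u ∈ F k A n) :
    θ k A ω * u ∈ F k A (n + 1) := by
  induction hu using Submodule.span_induction with
  | mem u h =>
    obtain ⟨l, hl, rfl⟩ := h
    exact Submodule.subset_span ⟨ω :: l, by simpa using hl, by simp⟩
  | zero => simp
  | add x y _ _ hx hy => rw [mul_add]; exact add_mem hx hy
  | smul c x hx' hx =>
    obtain ⟨b, hb⟩ := θ_comm ω c
    rw [smul_eq, ← mul_assoc, hb, add_mul, mul_assoc]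
    exact add_mem (Submodule.smul_mem _ c hx)
      (Submodule.smul_mem _ b (F_mono (Nat.le_succ n) hx'))

theorem θ_mul_mem_Fpred (ω : Ω[A⁄k]) {n : ℕ} {u : Env k A} (hu : u ∈ Fpred k A n) :
    θ k A ω * u ∈ Fpred k A (n + 1) := by
  cases n with
  | zero => rw [(Submodule.mem_bot A).1 hu, mul_zero]; exact zero_mem _
  | succ n => exact θ_mul_mem_F ω hu

theorem prod_comm (l : List (Ω[A⁄k])) (a : A) :
    (l.map (θ k A)).prod * m k A a - m k A a * (l.map (θ k A)).prod ∈ Fpred k A l.length := by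
  induction l with
  | nil => simp
  | cons ω l ih =>
    obtain ⟨b, hb⟩ := θ_comm ω a
    have e : θ k A ω * (l.map (θ k A)).prod * m k A a - m k A a * (θ k A ω * (l.map (θ k A)).prod)
        = θ k A ω * ((l.map (θ k A)).prod * m k A a - m k A a * (l.map (θ k A)).prod)
          + m k A b * (l.map (θ k A)).prod := by
      rw [mul_sub, ← mul_assoc (θ k A ω) (m k A a), hb, add_mul]
      simp only [mul_assoc]
      abel
    rw [List.map_cons, List.prod_cons, e, List.length_cons]
    exact add_mem (θ_mul_mem_Fpred ω ih) (Submodule.smul_mem _ b (prod_mem_F l))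

/-- `m_A` is central in the associated graded algebra. -/
theorem F_comm {n : ℕ} {u : Env k A} (hu : u ∈ F k A n) (a : A) :
    u * m k A a - m k A a * u ∈ Fpred k A n := by
  induction hu using Submodule.span_induction with
  | mem u h =>
    obtain ⟨l, hl, rfl⟩ := h
    exact Fpred_mono hl (prod_comm l a)
  | zero => simp
  | add x y _ _ hx hy =>
    have e : (x + y) * m k A a - m k A a * (x + y)
        = (x * m k A a - m k A a * x) + (y * m k A a - m k A a * y) := by
      rw [add_mul, mul_add]; abel
    rw [e]; exact add_mem hx hy
  | smul c x _ hx =>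
    have e : (c • x) * m k A a - m k A a * (c • x) = c • (x * m k A a - m k A a * x) := by
      rw [smul_eq, smul_eq, mul_sub, ← mul_assoc, ← mul_assoc, ← mul_assoc, ← map_mul, ← map_mul,
        mul_comm a c]
    rw [e]; exact Submodule.smul_mem _ c hx

theorem F_mul {i j : ℕ} {u w : Env k A} (hu : u ∈ F k A i) (hw : w ∈ F k A j) :
    u * w ∈ F k A (i + j) := by
  induction hu using Submodule.span_induction with
  | mem u h =>
    obtain ⟨l, hl, rfl⟩ := h
    refine F_mono (Nat.add_le_add_right hl j) ?_
    clear hl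
    induction l with
    | nil => simpa using hw
    | cons ω l ih =>
      rw [List.map_cons, List.prod_cons, mul_assoc, List.length_cons,
        show l.length + 1 + j = l.length + j + 1 by omega]
      exact θ_mul_mem_F ω ih
  | zero => simp
  | add x y _ _ hx hy => rw [add_mul]; exact add_mem hx hy
  | smul c x _ hx => rw [smul_eq, mul_assoc]; exact Submodule.smul_mem _ c hx

theorem Fpred_mul {i j : ℕ} {u w : Env k A} (hu : u ∈ Fpred k A i) (hw : w ∈ F k A j) :
    u * w ∈ Fpred k A (i + j) := by
  cases i with
  | zero => rw [(Submodule.mem_bot A).1 hu, zero_mul]; exact zero_mem _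
  | succ i =>
    rw [show i + 1 + j = i + j + 1 by omega]
    exact F_mul (k := k) (A := A) (i := i) hu hw

theorem mul_Fpred {i j : ℕ} {u w : Env k A} (hu : u ∈ F k A i) (hw : w ∈ Fpred k A j) :
    u * w ∈ Fpred k A (i + j) := by
  cases j with
  | zero => rw [(Submodule.mem_bot A).1 hw, mul_zero]; exact zero_mem _
  | succ j => exact F_mul (k := k) (A := A) (j := j) hu hw

variable (k A)

/-- The `n`-th graded piece `F_n / F_{n-1}`. -/
def GrPiece (n : ℕ) : Type (max u v) := F k A n ⧸ (Fpred k A n).submoduleOf (F k A n)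

noncomputable instance (n : ℕ) : AddCommGroup (GrPiece k A n) :=
  inferInstanceAs (AddCommGroup (F k A n ⧸ (Fpred k A n).submoduleOf (F k A n)))

noncomputable instance (n : ℕ) : Module A (GrPiece k A n) :=
  inferInstanceAs (Module A (F k A n ⧸ (Fpred k A n).submoduleOf (F k A n)))

variable {k A}

/-- The class in `F_n / F_{n-1}` of an element of `F_n`. -/
noncomputable def cls (n : ℕ) (u : Env k A) (hu : u ∈ F k A n) : GrPiece k A n :=
  Submodule.Quotient.mk ⟨u, hu⟩

theorem cls_eq_iff {n : ℕ} {u w : Env k A} {hu : u ∈ F k A n} {hw : w ∈ F k A n} :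
    cls n u hu = cls n w hw ↔ u - w ∈ Fpred k A n :=
  Submodule.Quotient.eq _

/-- The product `F_i / F_{i-1} × F_j / F_{j-1} → F_{i+j} / F_{i+j-1}` induced by that of `A^e`. -/
noncomputable def grMul {i j : ℕ} (x : GrPiece k A i) (y : GrPiece k A j) : GrPiece k A (i + j) :=
  Quotient.liftOn₂' x y (fun u w => cls (i + j) (u.1 * w.1) (F_mul u.2 w.2)) (by
    intro u w u' w' hu hw
    have hu' : u.1 - u'.1 ∈ Fpred k A i :=
      (Submodule.quotientRel_def ((Fpred k A i).submoduleOf (F k A i))).1 hu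
    have hw' : w.1 - w'.1 ∈ Fpred k A j :=
      (Submodule.quotientRel_def ((Fpred k A j).submoduleOf (F k A j))).1 hw
    refine cls_eq_iff.2 ?_
    have e : u.1 * w.1 - u'.1 * w'.1 = (u.1 - u'.1) * w.1 + u'.1 * (w.1 - w'.1) := by
      rw [sub_mul, mul_sub]; abel
    rw [e]
    exact add_mem (Fpred_mul hu' w.2) (mul_Fpred u'.2 hw'))

theorem cls_ind {n : ℕ} {P : GrPiece k A n → Prop} (H : ∀ u hu, P (cls n u hu))
    (x : GrPiece k A n) : P x :=
  Quotient.inductionOn' x (fun u => H u.1 u.2)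

theorem grMul_cls {i j : ℕ} (u w : Env k A) (hu : u ∈ F k A i) (hw : w ∈ F k A j) :
    grMul (cls i u hu) (cls j w hw) = cls (i + j) (u * w) (F_mul hu hw) := rfl

theorem cls_add {n : ℕ} (u w : Env k A) (hu : u ∈ F k A n) (hw : w ∈ F k A n) :
    cls n u hu + cls n w hw = cls n (u + w) (add_mem hu hw) := rfl

theorem cls_zero (n : ℕ) : cls n (0 : Env k A) (zero_mem _) = 0 := rfl

theorem cls_smul {n : ℕ} (a : A) (u : Env k A) (hu : u ∈ F k A n) :
    a • cls n u hu = cls n (m k A a * u) (Submodule.smul_mem _ a hu) := rfl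

theorem mk_cls_eq {i j : ℕ} (h : i = j) {u w : Env k A} (e : u = w) (hu : u ∈ F k A i)
    (hw : w ∈ F k A j) :
    GradedMonoid.mk (A := GrPiece k A) i (cls i u hu) = GradedMonoid.mk j (cls j w hw) := by
  subst h; subst e; rfl

theorem natCast_mem_F (n : ℕ) : (n : Env k A) ∈ F k A 0 := by
  rw [← map_natCast (m k A) n]; exact m_mem_F _

theorem intCast_mem_F (n : ℤ) : (n : Env k A) ∈ F k A 0 := by
  rw [← map_intCast (m k A) n]; exact m_mem_F _

noncomputable instance : GradedMonoid.GMul (GrPiece k A) where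
  mul := grMul

noncomputable instance : GradedMonoid.GOne (GrPiece k A) where
  one := cls 0 1 one_mem_F

noncomputable instance : GradedMonoid.GMonoid (GrPiece k A) where
  one_mul := by
    rintro ⟨i, a⟩
    induction a using cls_ind with
    | H u hu => exact mk_cls_eq (zero_add i) (one_mul u) _ _
  mul_one := by
    rintro ⟨i, a⟩
    induction a using cls_ind with
    | H u hu => exact mk_cls_eq (add_zero i) (mul_one u) _ _
  mul_assoc := by
    rintro ⟨i, a⟩ ⟨j, b⟩ ⟨l, c⟩
    induction a using cls_ind with
    | H u hu =>
    induction b using cls_ind with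
    | H w hw =>
    induction c using cls_ind with
    | H t ht => exact mk_cls_eq (add_assoc i j l) (mul_assoc u w t) _ _

noncomputable instance : DirectSum.GRing (GrPiece k A) where
  __ := (inferInstance : GradedMonoid.GMonoid (GrPiece k A))
  mul_zero {i j} a := by
    induction a using cls_ind with
    | H u hu => exact (grMul_cls u 0 hu (zero_mem _)).trans (cls_eq_iff.2 (by simp))
  zero_mul {i j} a := by
    induction a using cls_ind with
    | H u hu => exact (grMul_cls 0 u (zero_mem _) hu).trans (cls_eq_iff.2 (by simp))
  mul_add {i j} a b c := by
    induction a using cls_ind with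
    | H u hu =>
    induction b using cls_ind with
    | H w hw =>
    induction c using cls_ind with
    | H t ht => exact cls_eq_iff.2 (by simp [mul_add])
  add_mul {i j} a b c := by
    induction a using cls_ind with
    | H u hu =>
    induction b using cls_ind with
    | H w hw =>
    induction c using cls_ind with
    | H t ht => exact cls_eq_iff.2 (by simp [add_mul])
  natCast n := cls 0 n (natCast_mem_F n)
  natCast_zero := cls_eq_iff.2 (by simp)
  natCast_succ n := cls_eq_iff.2 (by simp)
  intCast n := cls 0 n (intCast_mem_F n)
  intCast_ofNat n := cls_eq_iff.2 (by simp)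
  intCast_negSucc_ofNat n := cls_eq_iff.2 (by simp)

theorem mk_mul_mk {i j : ℕ} (u w : Env k A) (hu : u ∈ F k A i) (hw : w ∈ F k A j) :
    GradedMonoid.mk (A := GrPiece k A) i (cls i u hu) * GradedMonoid.mk j (cls j w hw) =
      GradedMonoid.mk (i + j) (cls (i + j) (u * w) (F_mul hu hw)) := rfl

/-- The map `A → F_0`, `a ↦ [m_a]`. -/
noncomputable def grC : A →+ GrPiece k A 0 where
  toFun := fun a => cls 0 (m k A a) (m_mem_F a)
  map_zero' := cls_eq_iff.2 (by simp)
  map_add' := fun a b => cls_eq_iff.2 (by simp)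

theorem grC_commutes (r : A) (x : GradedMonoid (GrPiece k A)) :
    GradedMonoid.mk 0 (grC r) * x = x * GradedMonoid.mk 0 (grC r) := by
  obtain ⟨i, a⟩ := x
  induction a using cls_ind with
  | H u hu =>
    have hr : m k A r * u ∈ F k A i := Submodule.smul_mem _ r hu
    have hl : u * m k A r ∈ F k A i := by
      have := F_mul hu (m_mem_F r)
      rwa [add_zero] at this
    have e : cls i (m k A r * u) hr = cls i (u * m k A r) hl :=
      (cls_eq_iff.2 (F_comm hu r)).symm
    calc _ = _ := mk_mul_mk (m k A r) u (m_mem_F r) hu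
      _ = GradedMonoid.mk i (cls i (m k A r * u) hr) :=
        mk_cls_eq (zero_add i) rfl (F_mul (m_mem_F r) hu) hr
      _ = GradedMonoid.mk i (cls i (u * m k A r) hl) := by rw [e]
      _ = GradedMonoid.mk (i + 0) (cls (i + 0) (u * m k A r) (F_mul hu (m_mem_F r))) :=
        mk_cls_eq (add_zero i).symm rfl hl _
      _ = _ := (mk_mul_mk u (m k A r) hu (m_mem_F r)).symm

theorem grC_smul (r : A) (x : GradedMonoid (GrPiece k A)) :
    r • x = GradedMonoid.mk 0 (grC r) * x := by
  obtain ⟨i, a⟩ := x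
  induction a using cls_ind with
  | H u hu =>
    calc r • GradedMonoid.mk (A := GrPiece k A) i (cls i u hu)
        = GradedMonoid.mk i (cls i (m k A r * u) (Submodule.smul_mem _ r hu)) := rfl
      _ = GradedMonoid.mk (0 + i) (cls (0 + i) (m k A r * u) (F_mul (m_mem_F r) hu)) :=
        mk_cls_eq (zero_add i).symm rfl _ _
      _ = _ := (mk_mul_mk (m k A r) u (m_mem_F r) hu).symm

/-- `gr_F A^e` is an `A`-algebra through `a ↦ [m_a] ∈ F_0`. -/
noncomputable instance : DirectSum.GAlgebra A (GrPiece k A) where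
  toFun := grC
  map_one := cls_eq_iff.2 (by simp)
  map_mul r s := mk_cls_eq (zero_add 0).symm (map_mul _ r s) _ _
  commutes := grC_commutes
  smul_def := grC_smul

variable (k A)

/-- The associated graded algebra `gr_F A^e = ⨁ F_n / F_{n-1}`, an `A`-algebra. -/
abbrev Gr : Type (max u v) := ⨁ n, GrPiece k A n

end Env

end Enveloping

end PoissonAlgebra

/-! Commutators of differentials drop to `F_1`, so `ω ↦ [θ ω]` extends to an algebra map `symToGr`
from the symmetric algebra to the graded algebra. It is onto because `F_n` is spanned by products of
at most `n` differentials. Injectivity is Rinehart's form of the Poincaré-Birkhoff-Witt theorem: it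
suffices to find an `A^e`-module in which such products have visibly independent leading terms.

The Poisson bracket turns `Ω_A` into a Lie-Rinehart algebra (`cotangent`), with `[dx, dy] = d{x, y}`
extended by the Koszul formula. If a Lie-Rinehart algebra `L` has an ordered `A`-basis, then `L`
acts on the polynomial ring in the basis elements: a basis element multiplies a monomial when the
result is already in order, and otherwise the action is forced by the commutation rule and recursion
on the degree. Each `l` acts as multiplication by `l` up to terms that do not raise the degree
(`act_sub_sym_mem`), and `act_comm` shows that this is a representation.

A projective `Ω_A` becomes free after adding a suitable free module
(`Module.Projective.free_prod_finsupp`). The flat `semidirect` product extends the Lie-Rinehart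
structure to the sum, so `A^e` acts on polynomials in a basis of the sum. Applying an element of
`F_n` to `1` and taking the part of degree `n` defines a symbol map on the graded algebra. Its
composite with `symToGr` is the map of symmetric algebras induced by the inclusion of the summand
`Ω_A` (`grSymbol_symToGr`), which has a retraction (`lift_sym_injective`). -/

/-! ### Lie-Rinehart algebras. -/

/-- The structure of a Lie-Rinehart algebra on the `A`-module `L`. -/
structure LieRinehart (k : Type*) (A : Type*) (L : Type*) [CommRing k] [CommRing A] [Algebra k A]
    [AddCommGroup L] [Module k L] [Module A L] where
  /-- The anchor, giving the action of `L` on `A`. -/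
  anchor : L →ₗ[A] Derivation k A A
  /-- The Lie bracket. -/
  br : L →ₗ[k] L →ₗ[k] L
  br_self : ∀ x, br x x = 0
  jacobi : ∀ x y z, br x (br y z) = br (br x y) z + br y (br x z)
  br_smul : ∀ x (a : A) y, br x (a • y) = a • br x y + anchor x a • y
  anchor_br : ∀ x y a, anchor (br x y) a = anchor x (anchor y a) - anchor y (anchor x a)

namespace LieRinehart

open MvPolynomial Module

variable {k A L ι : Type*} [CommRing k] [CommRing A] [Algebra k A]
  [AddCommGroup L] [Module k L] [Module A L]

theorem br_skew (S : LieRinehart k A L) (x y : L) : S.br x y = - S.br y x := by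
  have h := S.br_self (x + y)
  simp only [map_add, LinearMap.add_apply, S.br_self, zero_add, add_zero] at h
  exact eq_neg_of_add_eq_zero_right h

/-! ### The degree filtration on polynomials and coefficientwise derivations. -/

/-- The monomial `z^J`, with coefficient `1`. -/
noncomputable def mon (A : Type*) [CommRing A] (J : ι →₀ ℕ) : MvPolynomial ι A := monomial J 1

theorem smul_mon (a : A) (J : ι →₀ ℕ) : a • mon A J = monomial J a := by
  simp [mon, smul_monomial]

theorem X_mul_mon (i : ι) (J : ι →₀ ℕ) : X i * mon A J = mon A (Finsupp.single i 1 + J) := by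
  simp [mon, X, monomial_mul]

theorem mon_induction {P : MvPolynomial ι A → Prop} (w : MvPolynomial ι A)
    (hm : ∀ (a : A) J, P (a • mon A J)) (ha : ∀ p q, P p → P q → P (p + q)) : P w := by
  induction w using MvPolynomial.induction_on' with
  | monomial J a => rw [← smul_mon]; exact hm a J
  | add p q hp hq => exact ha p q hp hq

/-- The polynomials of degree at most `n`. -/
noncomputable def fil (ι A : Type*) [CommRing A] (n : ℕ) : Submodule A (MvPolynomial ι A) :=
  Submodule.span A {w | ∃ J : ι →₀ ℕ, J.degree ≤ n ∧ mon A J = w}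

theorem mon_mem_fil {J : ι →₀ ℕ} {n : ℕ} (h : J.degree ≤ n) : mon A J ∈ fil ι A n :=
  Submodule.subset_span ⟨J, h, rfl⟩

theorem fil_mono {m n : ℕ} (h : m ≤ n) : fil ι A m ≤ fil ι A n :=
  Submodule.span_mono (fun _ ⟨J, hJ, e⟩ => ⟨J, hJ.trans h, e⟩)

theorem exists_mem_fil (w : MvPolynomial ι A) : ∃ n, w ∈ fil ι A n := by
  induction w using mon_induction with
  | hm a J => exact ⟨J.degree, Submodule.smul_mem _ a (mon_mem_fil le_rfl)⟩
  | ha p q hp hq =>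
    obtain ⟨m, hm⟩ := hp
    obtain ⟨n, hn⟩ := hq
    exact ⟨max m n, add_mem (fil_mono (le_max_left _ _) hm) (fil_mono (le_max_right _ _) hn)⟩

/-- The coefficientwise action of a derivation. -/
noncomputable def coeffDer (ι : Type*) (D : Derivation k A A) :
    MvPolynomial ι A →ₗ[k] MvPolynomial ι A :=
  ((basisMonomials ι A).repr.symm.toLinearMap.restrictScalars k) ∘ₗ
    Finsupp.mapRange.linearMap D.toLinearMap ∘ₗ
    ((basisMonomials ι A).repr.toLinearMap.restrictScalars k)

theorem coeffDer_smul_mon (D : Derivation k A A) (a : A) (J : ι →₀ ℕ) :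
    coeffDer ι D (a • mon A J) = D a • mon A J := by
  have h : (mon A J) = basisMonomials ι A J := by simp [mon]
  have h' : (basisMonomials ι A).repr (a • mon A J) = Finsupp.single J a := by
    rw [h, map_smul, Basis.repr_self, Finsupp.smul_single, smul_eq_mul, mul_one]
  change (basisMonomials ι A).repr.symm
    (Finsupp.mapRange.linearMap D.toLinearMap ((basisMonomials ι A).repr (a • mon A J))) = _
  rw [h', Finsupp.mapRange.linearMap_apply, Finsupp.mapRange_single, Basis.repr_symm_single, h]
  rfl

theorem coeffDer_mon (D : Derivation k A A) (J : ι →₀ ℕ) : coeffDer ι D (mon A J) = 0 := by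
  simpa using coeffDer_smul_mon D (1 : A) J

theorem coeffDer_smul (D : Derivation k A A) (a : A) (w : MvPolynomial ι A) :
    coeffDer ι D (a • w) = D a • w + a • coeffDer ι D w := by
  induction w using mon_induction with
  | hm c J =>
    rw [smul_smul, coeffDer_smul_mon, coeffDer_smul_mon, D.leibniz]
    simp only [smul_smul, add_smul, smul_eq_mul]
    rw [mul_comm c, add_comm]
  | ha p q hp hq => simp only [smul_add, map_add, hp, hq]; abel

theorem coeffDer_add_left (D E : Derivation k A A) (w : MvPolynomial ι A) :
    coeffDer ι (D + E) w = coeffDer ι D w + coeffDer ι E w := by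
  induction w using mon_induction with
  | hm c J => simp only [coeffDer_smul_mon, Derivation.add_apply, add_smul]
  | ha p q hp hq => simp only [map_add, hp, hq]; abel

theorem coeffDer_smul_left (a : A) (D : Derivation k A A) (w : MvPolynomial ι A) :
    coeffDer ι (a • D) w = a • coeffDer ι D w := by
  induction w using mon_induction with
  | hm c J => simp only [coeffDer_smul_mon, Derivation.smul_apply, smul_assoc]
  | ha p q hp hq => simp only [map_add, hp, hq, smul_add]

/-- The linear form of degree one attached to an element of a free module. -/
noncomputable def sym (b : Basis ι A L) : L →ₗ[A] MvPolynomial ι A := b.constr A X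

theorem sym_basis (b : Basis ι A L) (i : ι) : sym b (b i) = X i := by
  simp [sym]

theorem basis_span_induction (b : Basis ι A L) {P : L → Prop} (l : L) (hb : ∀ i, P (b i))
    (h0 : P 0) (ha : ∀ x y, P x → P y → P (x + y)) (hs : ∀ (a : A) x, P x → P (a • x)) : P l := by
  have hl : l ∈ Submodule.span A (Set.range b) := by rw [b.span_eq]; trivial
  induction hl using Submodule.span_induction with
  | mem x hx => obtain ⟨i, rfl⟩ := hx; exact hb i
  | zero => exact h0
  | add x y _ _ hx hy => exact ha x y hx hy
  | smul a x _ hx => exact hs a x hx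

theorem sym_mul_mem (b : Basis ι A L) (l : L) {n : ℕ} {w : MvPolynomial ι A}
    (hw : w ∈ fil ι A n) : sym b l * w ∈ fil ι A (n + 1) := by
  induction l using basis_span_induction b with
  | hb i =>
    rw [sym_basis]
    induction hw using Submodule.span_induction with
    | mem w h =>
      obtain ⟨J, hJ, rfl⟩ := h
      rw [X_mul_mon]
      refine mon_mem_fil ?_
      rw [map_add, Finsupp.degree_single]
      omega
    | zero => simp
    | add x y _ _ hx hy => rw [mul_add]; exact add_mem hx hy
    | smul c x _ hx => rw [mul_smul_comm]; exact Submodule.smul_mem _ c hx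
  | h0 => simp
  | ha x y hx hy => rw [map_add, add_mul]; exact add_mem hx hy
  | hs a x hx => rw [map_smul, smul_mul_assoc]; exact Submodule.smul_mem _ a hx

/-! ### Operators on polynomials prescribed on basis elements and monomials. -/

/-- The operator by which `l` acts on polynomials, when the action of the basis element `b i` on
the monomial `z^J` is `f i J`. -/
noncomputable def op (S : LieRinehart k A L) (b : Basis ι A L)
    (f : ι → (ι →₀ ℕ) → MvPolynomial ι A) (l : L) : MvPolynomial ι A →ₗ[k] MvPolynomial ι A :=
  coeffDer ι (S.anchor l) +
    (b.constr A (fun i => (basisMonomials ι A).constr A (f i)) l).restrictScalars k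

section op

variable (S : LieRinehart k A L) (b : Basis ι A L) (f : ι → (ι →₀ ℕ) → MvPolynomial ι A)

theorem op_basis_mon (i : ι) (J : ι →₀ ℕ) : op S b f (b i) (mon A J) = f i J := by
  have h : (mon A J) = basisMonomials ι A J := by simp [mon]
  rw [op, LinearMap.add_apply, coeffDer_mon, h, zero_add, LinearMap.restrictScalars_apply,
    Basis.constr_basis, Basis.constr_basis]

theorem op_smul (l : L) (a : A) (w : MvPolynomial ι A) :
    op S b f l (a • w) = S.anchor l a • w + a • op S b f l w := by
  simp only [op, LinearMap.add_apply, coeffDer_smul, LinearMap.restrictScalars_apply, map_smul,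
    smul_add, add_assoc]

theorem op_add_left (l l' : L) (w : MvPolynomial ι A) :
    op S b f (l + l') w = op S b f l w + op S b f l' w := by
  simp only [op, LinearMap.add_apply, map_add, coeffDer_add_left, LinearMap.restrictScalars_apply]
  abel

theorem op_smul_left (a : A) (l : L) (w : MvPolynomial ι A) :
    op S b f (a • l) w = a • op S b f l w := by
  simp only [op, LinearMap.add_apply, map_smul, coeffDer_smul_left, LinearMap.smul_apply,
    LinearMap.restrictScalars_apply, smul_add]

theorem op_zero_left (w : MvPolynomial ι A) : op S b f 0 w = 0 := by
  simpa using op_smul_left S b f 0 0 w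

theorem op_neg_left (l : L) (w : MvPolynomial ι A) : op S b f (-l) w = - op S b f l w := by
  simpa using op_smul_left S b f (-1) l w

variable {f}

/-- The hypothesis is the case of basis elements and monomials. It propagates because the defect is
`A`-linear in `l`, and pulling a scalar `c` out of `w` costs only `S.anchor l c • w`, which has no
larger degree. -/
theorem op_sub_sym_mem (hf : ∀ i J, f i J - mon A (Finsupp.single i 1 + J) ∈ fil ι A J.degree)
    (l : L) {n : ℕ} {w : MvPolynomial ι A} (hw : w ∈ fil ι A n) :
    op S b f l w - sym b l * w ∈ fil ι A n := by
  induction l using basis_span_induction b with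
  | hb i =>
    induction hw using Submodule.span_induction with
    | mem w h =>
      obtain ⟨J, hJ, rfl⟩ := h
      rw [sym_basis, op_basis_mon, X_mul_mon]
      exact fil_mono hJ (hf i J)
    | zero => simp
    | add x y _ _ hx hy =>
      rw [map_add, mul_add, add_sub_add_comm]; exact add_mem hx hy
    | smul c x hx' hx =>
      rw [op_smul, mul_smul_comm, add_sub_assoc, ← smul_sub]
      exact add_mem (Submodule.smul_mem _ _ hx') (Submodule.smul_mem _ c hx)
  | h0 => simp [op_zero_left]
  | ha x y hx hy => rw [op_add_left, map_add, add_mul, add_sub_add_comm]; exact add_mem hx hy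
  | hs a x hx =>
    rw [op_smul_left, map_smul, smul_mul_assoc, ← smul_sub]; exact Submodule.smul_mem _ a hx

theorem op_mem (hf : ∀ i J, f i J - mon A (Finsupp.single i 1 + J) ∈ fil ι A J.degree)
    (l : L) {n : ℕ} {w : MvPolynomial ι A} (hw : w ∈ fil ι A n) :
    op S b f l w ∈ fil ι A (n + 1) := by
  have h := add_mem (fil_mono n.le_succ (op_sub_sym_mem S b hf l hw)) (sym_mul_mem b l hw)
  rwa [sub_add_cancel] at h

/-- This locality makes a recursion on degree possible: on polynomials of degree at most `n` the
operator sees only the values of `f` on monomials of degree at most `n`. -/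
theorem op_congr {f' : ι → (ι →₀ ℕ) → MvPolynomial ι A} {n : ℕ}
    (h : ∀ i J, J.degree ≤ n → f i J = f' i J) (l : L) {w : MvPolynomial ι A}
    (hw : w ∈ fil ι A n) : op S b f l w = op S b f' l w := by
  induction l using basis_span_induction b with
  | hb i =>
    induction hw using Submodule.span_induction with
    | mem w h' =>
      obtain ⟨J, hJ, rfl⟩ := h'
      rw [op_basis_mon, op_basis_mon, h i J hJ]
    | zero => simp
    | add x y _ _ hx hy => rw [map_add, map_add, hx, hy]
    | smul c x _ hx => rw [op_smul, op_smul, hx]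
  | h0 => rw [op_zero_left, op_zero_left]
  | ha x y hx hy => rw [op_add_left, op_add_left, hx, hy]
  | hs a x hx => rw [op_smul_left, op_smul_left, hx]

end op

theorem degree_sub_single {J : ι →₀ ℕ} {m : ι} (h : m ∈ J.support) :
    (J - Finsupp.single m 1).degree + 1 = J.degree := by
  have h1 : Finsupp.single m 1 ≤ J := by
    rw [Finsupp.single_le_iff]
    exact Nat.one_le_iff_ne_zero.2 (Finsupp.mem_support_iff.1 h)
  conv_rhs => rw [← tsub_add_cancel_of_le h1, map_add, Finsupp.degree_single]

/-! ### The normally ordered action on polynomials. -/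

section Action

variable [LinearOrder ι] (S : LieRinehart k A L) (b : Basis ι A L)

/-- The action of basis elements on monomials, correct on monomials of degree at most `n`. -/
noncomputable def actAux : ℕ → ι → (ι →₀ ℕ) → MvPolynomial ι A
  | 0, i, J => mon A (Finsupp.single i 1 + J)
  | n + 1, i, J =>
    if J.degree ≤ n then actAux n i J
    else if h : J.support.Nonempty then
      if i ≤ J.support.min' h then mon A (Finsupp.single i 1 + J)
      -- Write `z^J = z_m z^M` with `m` the least index, `m < i`. The commutation rule forces `i ·
      -- z^J = m · (i · z^M) + [i, m] · z^M`. The leading term `z_i z^M` of `i · z^M` has degree `n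
      -- + 1`, beyond the reach of `actAux n`, but `m` must multiply it plainly, giving `z_i z^J`.
      -- Only the remainder, of degree at most `n`, is handled recursively.
      else mon A (Finsupp.single i 1 + J) +
        (op S b (actAux n) (b (J.support.min' h))
          (op S b (actAux n) (b i) (mon A (J - Finsupp.single (J.support.min' h) 1)) -
            mon A (Finsupp.single i 1 + (J - Finsupp.single (J.support.min' h) 1))) +
        op S b (actAux n) (S.br (b i) (b (J.support.min' h)))
          (mon A (J - Finsupp.single (J.support.min' h) 1)))
    -- Never reached: here the degree of `J` exceeds `n`, so `J` has nonempty support.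
    else mon A (Finsupp.single i 1 + J)

/-- Both correction terms apply an operator raising the degree by at most one to a polynomial of
degree at most `|J| - 1`. -/
theorem actAux_sub_mem (n : ℕ) (i : ι) (J : ι →₀ ℕ) :
    actAux S b n i J - mon A (Finsupp.single i 1 + J) ∈ fil ι A J.degree := by
  induction n generalizing i J with
  | zero => simp [actAux]
  | succ n ih =>
    rw [actAux]
    split_ifs with h1 h2 h3
    · exact ih i J
    · simp
    · have hd := degree_sub_single (Finset.min'_mem _ h2)
      have hM : mon A (J - Finsupp.single (J.support.min' h2) 1) ∈
        fil ι A (J - Finsupp.single (J.support.min' h2) 1).degree := mon_mem_fil le_rfl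
      rw [add_sub_cancel_left, ← hd]
      refine add_mem (op_mem S b ih _ ?_) (op_mem S b ih _ hM)
      have := op_sub_sym_mem S b ih (b i) hM
      rwa [sym_basis, X_mul_mon] at this
    · simp

/-- The action of basis elements on monomials. -/
noncomputable def actMon (i : ι) (J : ι →₀ ℕ) : MvPolynomial ι A := actAux S b J.degree i J

theorem actAux_eq {n : ℕ} (i : ι) {J : ι →₀ ℕ} (h : J.degree ≤ n) :
    actAux S b n i J = actMon S b i J := by
  induction n with
  | zero => rw [actMon, Nat.le_zero.1 h]
  | succ n ih =>
    rcases h.eq_or_lt with h | h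
    · rw [actMon, h]
    · rw [actAux, if_pos (Nat.lt_succ_iff.1 h), ih (Nat.lt_succ_iff.1 h)]

/-- The action of `L` on polynomials. -/
noncomputable def act (l : L) : MvPolynomial ι A →ₗ[k] MvPolynomial ι A := op S b (actMon S b) l

theorem act_sub_sym_mem (l : L) {n : ℕ} {w : MvPolynomial ι A} (hw : w ∈ fil ι A n) :
    act S b l w - sym b l * w ∈ fil ι A n :=
  op_sub_sym_mem S b (fun i J => actAux_sub_mem S b J.degree i J) l hw

theorem act_mem (l : L) {n : ℕ} {w : MvPolynomial ι A} (hw : w ∈ fil ι A n) :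
    act S b l w ∈ fil ι A (n + 1) :=
  op_mem S b (fun i J => actAux_sub_mem S b J.degree i J) l hw

theorem op_actAux (l : L) {n : ℕ} {w : MvPolynomial ι A} (hw : w ∈ fil ι A n) :
    op S b (actAux S b n) l w = act S b l w :=
  op_congr S b (fun i _ hJ => actAux_eq S b i hJ) l hw

theorem act_of_le {i : ι} {J : ι →₀ ℕ} (h : ∀ j ∈ J.support, i ≤ j) :
    act S b (b i) (mon A J) = mon A (Finsupp.single i 1 + J) := by
  rw [act, op_basis_mon, actMon]
  generalize hn : J.degree = n
  cases n with
  | zero => rfl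
  | succ n =>
    rw [actAux, if_neg (by omega)]
    split_ifs with h2 h3
    · rfl
    · exact absurd (h _ (Finset.min'_mem _ h2)) h3
    · rfl

/-- The recursion freed of its bookkeeping. The leading monomial of `b i` acting on `z^M`, which the
definition treats apart, has no index below `m`, so `act_of_le` says that `b m` multiplies it and
the pieces recombine. -/
theorem act_of_lt {i m : ι} {M : ι →₀ ℕ} (hm : m < i) (h : ∀ j ∈ M.support, m ≤ j) :
    act S b (b i) (mon A (Finsupp.single m 1 + M)) =
      act S b (b m) (act S b (b i) (mon A M)) + act S b (S.br (b i) (b m)) (mon A M) := by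
  have hmem : m ∈ (Finsupp.single m 1 + M).support := by simp
  have h2 : (Finsupp.single m 1 + M).support.Nonempty := ⟨m, hmem⟩
  have hmin : (Finsupp.single m 1 + M).support.min' h2 = m := by
    refine le_antisymm (Finset.min'_le _ _ hmem) (Finset.le_min' _ _ _ fun j hj => ?_)
    rcases eq_or_ne j m with rfl | hne
    · exact le_rfl
    · refine h j ?_
      have : ¬ m = j := fun h => hne h.symm
      simpa [Finsupp.single_apply, this] using hj
  have hd : (Finsupp.single m 1 + M).degree = M.degree + 1 := by
    rw [map_add, Finsupp.degree_single, add_comm]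
  have hM : mon A M ∈ fil ι A M.degree := mon_mem_fil le_rfl
  have hc : act S b (b i) (mon A M) - mon A (Finsupp.single i 1 + M) ∈ fil ι A M.degree := by
    have := act_sub_sym_mem S b (b i) hM
    rwa [sym_basis, X_mul_mon] at this
  have hle : ∀ j ∈ (Finsupp.single i 1 + M).support, m ≤ j := fun j hj => by
    rcases Finset.mem_union.1 (Finsupp.support_add hj) with hj | hj
    · rw [Finset.mem_singleton.1 (Finsupp.support_single_subset hj)]; exact hm.le
    · exact h j hj
  rw [act, op_basis_mon, actMon, hd, actAux, if_neg (by omega), dif_pos h2, hmin, if_neg hm.not_ge,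
    add_tsub_cancel_left, op_actAux S b _ hM, op_actAux S b _ hM, op_actAux S b _ hc, map_sub,
    act_of_le S b hle, add_left_comm (Finsupp.single i 1)]
  change _ = act S b (b m) (act S b (b i) (mon A M)) + _
  abel

/-! ### The commutator identity for the action. -/

/-- The operators attached to `x` and `y` have the expected commutator on `w`. -/
def Comm (x y : L) (w : MvPolynomial ι A) : Prop :=
  act S b x (act S b y w) - act S b y (act S b x w) = act S b (S.br x y) w

variable {S b}

theorem Comm.symm {x y : L} {w : MvPolynomial ι A} (h : Comm S b x y w) : Comm S b y x w := by
  have e : act S b (S.br y x) w = - act S b (S.br x y) w := by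
    rw [S.br_skew]; exact op_neg_left S b _ _ _
  rw [Comm, e, ← h]
  abel

theorem Comm.zero_right (x : L) (w : MvPolynomial ι A) : Comm S b x 0 w := by
  simp [Comm, act, op_zero_left]

theorem Comm.add_right {x y z : L} {w : MvPolynomial ι A} (h : Comm S b x y w)
    (h' : Comm S b x z w) : Comm S b x (y + z) w := by
  have e : act S b (S.br x (y + z)) w = act S b (S.br x y) w + act S b (S.br x z) w := by
    rw [map_add]; exact op_add_left S b _ _ _ _
  have e' : ∀ w, act S b (y + z) w = act S b y w + act S b z w := op_add_left S b _ y z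
  rw [Comm, e, ← h, ← h', e', e', map_add]
  abel

theorem act_smul (l : L) (a : A) (w : MvPolynomial ι A) :
    act S b l (a • w) = S.anchor l a • w + a • act S b l w := op_smul S b _ l a w

theorem act_smul_left (a : A) (l : L) (w : MvPolynomial ι A) :
    act S b (a • l) w = a • act S b l w := op_smul_left S b _ a l w

theorem act_add_left (l l' : L) (w : MvPolynomial ι A) :
    act S b (l + l') w = act S b l w + act S b l' w := op_add_left S b _ l l' w

/-- The commutator defect is tensorial: the term `S.anchor x a • y` in the bracket matches the one
produced when `x` acts past the coefficient `a`. -/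
theorem Comm.smul_right {x y : L} {w : MvPolynomial ι A} (a : A) (h : Comm S b x y w) :
    Comm S b x (a • y) w := by
  rw [Comm] at h
  rw [Comm, S.br_smul, act_add_left, act_smul_left a (S.br x y), act_smul_left (S.anchor x a), ← h,
    act_smul_left, act_smul_left, act_smul, smul_sub]
  abel

theorem Comm.add_arg {x y : L} {w w' : MvPolynomial ι A} (h : Comm S b x y w)
    (h' : Comm S b x y w') : Comm S b x y (w + w') := by
  simp only [Comm, map_add] at *
  rw [← h, ← h']
  abel

/-- The defect is also linear in the polynomial. The mixed first-order terms cancel, and the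
second-order terms agree because the anchor preserves brackets. -/
theorem Comm.smul_arg {x y : L} {w : MvPolynomial ι A} (a : A) (h : Comm S b x y w) :
    Comm S b x y (a • w) := by
  rw [Comm] at h
  simp only [Comm, act_smul, map_add, S.anchor_br, ← h, smul_sub, sub_smul]
  abel

theorem Comm.of_basis {w : MvPolynomial ι A} (h : ∀ i j, Comm S b (b i) (b j) w) (x y : L) :
    Comm S b x y w := by
  induction y using basis_span_induction b with
  | hb j =>
    refine Comm.symm ?_
    induction x using basis_span_induction b with
    | hb i => exact h j i
    | h0 => exact .zero_right _ _
    | ha x y hx hy => exact hx.add_right hy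
    | hs a x hx => exact hx.smul_right a
  | h0 => exact .zero_right _ _
  | ha x y hx hy => exact hx.add_right hy
  | hs a x hx => exact hx.smul_right a

theorem Comm.of_fil {x y : L} {n : ℕ} (h : ∀ J : ι →₀ ℕ, J.degree ≤ n → Comm S b x y (mon A J))
    {w : MvPolynomial ι A} (hw : w ∈ fil ι A n) : Comm S b x y w := by
  induction hw using Submodule.span_induction with
  | mem w h' =>
    obtain ⟨J, hJ, rfl⟩ := h'
    exact h J hJ
  | zero => simp [Comm]
  | add x y _ _ hx hy => exact hx.add_arg hy
  | smul c x _ hx => exact hx.smul_arg c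

theorem Comm.of_le {i j : ι} {J : ι →₀ ℕ} (hij : j < i) (h : ∀ l ∈ J.support, j ≤ l) :
    Comm S b (b i) (b j) (mon A J) := by
  rw [Comm, act_of_le S b h, act_of_lt S b hij h]
  abel

/-- The heart of the Poincaré-Birkhoff-Witt argument, by induction on degree. For `j < i`, if `j` is
at most every index of `J` the identity is the recursive definition itself. Otherwise `z^J = b m ·
z^M` with `m < j < i`; moving `b m` to the front of both double products reduces the identity to
lower degree and the Jacobi identity. -/
theorem Comm.basis_mon (n : ℕ) : ∀ (J : ι →₀ ℕ), J.degree ≤ n → ∀ i j,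
    Comm S b (b i) (b j) (mon A J) := by
  induction n using Nat.strong_induction_on with
  | _ n ih =>
  intro J hJ
  have main : ∀ i j, j < i → Comm S b (b i) (b j) (mon A J) := by
    intro i j hij
    by_cases hle : ∀ l ∈ J.support, j ≤ l
    · exact .of_le hij hle
    have h2 : J.support.Nonempty := by
      by_contra h
      rw [Finset.not_nonempty_iff_eq_empty] at h
      simp [h] at hle
    obtain ⟨m, hmJ, hmin⟩ : ∃ m ∈ J.support, ∀ l ∈ J.support, m ≤ l :=
      ⟨_, Finset.min'_mem _ h2, fun l hl => Finset.min'_le _ l hl⟩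
    have hmj : m < j := by
      push Not at hle
      obtain ⟨l, hl, hlj⟩ := hle
      exact (hmin l hl).trans_lt hlj
    obtain ⟨M, rfl⟩ : ∃ M, J = Finsupp.single m 1 + M := by
      refine ⟨J - Finsupp.single m 1, (add_tsub_cancel_of_le ?_).symm⟩
      rw [Finsupp.single_le_iff]
      exact Nat.one_le_iff_ne_zero.2 (Finsupp.mem_support_iff.1 hmJ)
    have hM : ∀ l ∈ M.support, m ≤ l := fun l hl => hmin l (by
      have := Finsupp.mem_support_iff.1 hl
      simp [this])
    have hd : M.degree < n := by
      rw [map_add, Finsupp.degree_single] at hJ; omega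
    have hMf : mon A M ∈ fil ι A M.degree := mon_mem_fil le_rfl
    have IH : ∀ x y w, w ∈ fil ι A M.degree → Comm S b x y w := fun x y w hw =>
      Comm.of_fil (fun J hJ => Comm.of_basis (ih _ hd J hJ) x y) hw
    have hmM : act S b (b m) (mon A M) = mon A (Finsupp.single m 1 + M) := act_of_le S b hM
    -- The polynomial `b q · z^M` may have the degree of `z^J`, where induction is unavailable. Its
    -- leading monomial has no index below `m`, so `Comm.of_le` covers it, and the remainder has
    -- degree at most `|M|`.
    have key : ∀ p q, m < p → m < q → Comm S b (b p) (b m) (act S b (b q) (mon A M)) := by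
      intro p q hp hq
      have e : act S b (b q) (mon A M) = mon A (Finsupp.single q 1 + M) +
          (act S b (b q) (mon A M) - mon A (Finsupp.single q 1 + M)) := by abel
      rw [e]
      refine Comm.add_arg (.of_le hp fun l hl => ?_) (IH _ _ _ ?_)
      · rcases Finset.mem_union.1 (Finsupp.support_add hl) with hl | hl
        · rw [Finset.mem_singleton.1 (Finsupp.support_single_subset hl)]; exact hq.le
        · exact hM l hl
      · have := act_sub_sym_mem S b (b q) hMf
        rwa [sym_basis, X_mul_mon] at this
    have hmi := hmj.trans hij
    -- The two middle terms are exchanged by swapping `p` and `q`, so they cancel when the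
    -- expansions for `(i, j)` and `(j, i)` are subtracted.
    have expand : ∀ p q, m < p → m < q →
        act S b (b p) (act S b (b q) (mon A (Finsupp.single m 1 + M))) =
          act S b (b m) (act S b (b p) (act S b (b q) (mon A M))) +
          act S b (S.br (b p) (b m)) (act S b (b q) (mon A M)) +
          act S b (S.br (b q) (b m)) (act S b (b p) (mon A M)) +
          act S b (S.br (b p) (S.br (b q) (b m))) (mon A M) := by
      intro p q hp hq
      have h1 := IH (b q) (b m) _ hMf
      have h2 := key p q hp hq
      have h3 := IH (b p) (S.br (b q) (b m)) _ hMf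
      rw [Comm, sub_eq_iff_eq_add] at h1 h2 h3
      rw [← hmM, h1, map_add, h2, h3]
      abel
    have h4 := IH (b i) (b j) _ hMf
    have h5 := IH (S.br (b i) (b j)) (b m) _ hMf
    have h6 : act S b (S.br (b i) (S.br (b j) (b m))) (mon A M) =
        act S b (S.br (S.br (b i) (b j)) (b m)) (mon A M) +
        act S b (S.br (b j) (S.br (b i) (b m))) (mon A M) := by
      rw [S.jacobi, act_add_left]
    rw [Comm] at h4 h5
    have h7 : act S b (b m) (act S b (S.br (b i) (b j)) (mon A M)) =
        act S b (b m) (act S b (b i) (act S b (b j) (mon A M))) -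
        act S b (b m) (act S b (b j) (act S b (b i) (mon A M))) := by
      rw [← map_sub, h4]
    rw [hmM, sub_eq_iff_eq_add] at h5
    rw [Comm, expand i j hmi hmj, expand j i hmj hmi, h5, h6, h7]
    abel
  intro i j
  rcases lt_trichotomy i j with h | rfl | h
  · exact (main j i h).symm
  · rw [Comm, S.br_self, sub_self, act, op_zero_left]
  · exact main i j h

/-- The operators `act` form a representation of the Lie-Rinehart algebra. -/
theorem act_comm (x y : L) (w : MvPolynomial ι A) :
    act S b x (act S b y w) - act S b y (act S b x w) = act S b (S.br x y) w := by
  obtain ⟨n, hw⟩ := exists_mem_fil w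
  exact Comm.of_fil (fun J hJ => Comm.of_basis (Comm.basis_mon n J hJ) x y) hw

end Action

end LieRinehart

/-! ### The Lie derivative on Kähler differentials. -/

namespace KaehlerDifferential

section LieDerivative

variable {k A : Type*} [CommRing k] [CommRing A] [Algebra k A]

theorem span_induction_D {P : Ω[A⁄k] → Prop} (ω : Ω[A⁄k]) (hD : ∀ x, P (D k A x))
    (h0 : P 0) (ha : ∀ x y, P x → P y → P (x + y)) (hs : ∀ (a : A) x, P x → P (a • x)) : P ω := by
  have hω : ω ∈ Submodule.span A (Set.range (D k A)) := by
    rw [span_range_derivation]; trivial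
  induction hω using Submodule.span_induction with
  | mem x hx => obtain ⟨i, rfl⟩ := hx; exact hD i
  | zero => exact h0
  | add x y _ _ hx hy => exact ha x y hx hy
  | smul a x _ hx => exact hs a x hx

/-- The Lie derivative on formal combinations of differentials. -/
noncomputable def lieDerAux (E : Derivation k A A) : (A →₀ A) →ₗ[k] Ω[A⁄k] :=
  Finsupp.lsum k fun y =>
    ((LinearMap.toSpanSingleton A (Ω[A⁄k]) (D k A y)).restrictScalars k ∘ₗ E.toLinearMap) +
      (LinearMap.toSpanSingleton A (Ω[A⁄k]) (D k A (E y))).restrictScalars k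

theorem lieDerAux_single (E : Derivation k A A) (y a : A) :
    lieDerAux E (Finsupp.single y a) = E a • D k A y + a • D k A (E y) := by
  simp [lieDerAux]

theorem lieDerAux_smul (E : Derivation k A A) (a : A) (f : A →₀ A) :
    lieDerAux E (a • f) = E a • Finsupp.linearCombination A (D k A) f + a • lieDerAux E f := by
  induction f using Finsupp.induction_linear with
  | zero => simp
  | add f g hf hg => simp only [smul_add, map_add, hf, hg]; abel
  | single y c =>
    rw [Finsupp.smul_single, lieDerAux_single, lieDerAux_single, Finsupp.linearCombination_single,
      smul_eq_mul, E.leibniz, smul_eq_mul, smul_eq_mul, smul_add, smul_smul, smul_smul, smul_smul,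
      add_smul, mul_comm c]
    abel

/-- The Lie derivative is not `A`-linear, so it is defined on the presentation of `Ω_A` and must be
seen to kill the relations. It kills the generating relations directly; for their multiples, the
extra term in `lieDerAux_smul` contains the image of a relation in `Ω_A`, which is zero. -/
theorem lieDerAux_kerTotal (E : Derivation k A A) {f : A →₀ A} (hf : f ∈ kerTotal k A) :
    lieDerAux E f = 0 := by
  rw [kerTotal] at hf
  induction hf using Submodule.span_induction with
  | mem f h =>
    obtain (⟨⟨x, y⟩, rfl⟩ | ⟨⟨x, y⟩, rfl⟩) | ⟨x, rfl⟩ := h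
    · simp [lieDerAux_single]
    · simp only [map_sub, map_add, lieDerAux_single, E.map_one_eq_zero, E.leibniz,
        Derivation.leibniz, smul_eq_mul, smul_add, one_smul, zero_smul]
      abel
    · simp [lieDerAux_single]
  | zero => simp
  | add x y _ _ hx hy => rw [map_add, hx, hy, add_zero]
  | smul a x hx' hx =>
    have h : Finsupp.linearCombination A (D k A) x = 0 := by
      have : x ∈ kerTotal k A := hx'
      rwa [← kerTotal_eq, LinearMap.mem_ker] at this
    rw [lieDerAux_smul, hx, h, smul_zero, smul_zero, add_zero]

/-- The Lie derivative of differential forms along a derivation. -/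
noncomputable def lieDer (E : Derivation k A A) : Ω[A⁄k] →ₗ[k] Ω[A⁄k] :=
  Submodule.liftQ ((kerTotal k A).restrictScalars k) (lieDerAux E)
      (fun _ hf => lieDerAux_kerTotal E hf) ∘ₗ
    (Submodule.Quotient.restrictScalarsEquiv k (kerTotal k A)).symm.toLinearMap ∘ₗ
    (quotKerTotalEquiv k A).symm.toLinearMap.restrictScalars k

theorem lieDer_linearCombination (E : Derivation k A A) (f : A →₀ A) :
    lieDer E (Finsupp.linearCombination A (D k A) f) = lieDerAux E f := by
  have h : (quotKerTotalEquiv k A).symm (Finsupp.linearCombination A (D k A) f) =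
      (kerTotal k A).mkQ f := by
    rw [LinearEquiv.symm_apply_eq]; rfl
  change Submodule.liftQ ((kerTotal k A).restrictScalars k) (lieDerAux E)
    (fun _ hf => lieDerAux_kerTotal E hf)
    ((Submodule.Quotient.restrictScalarsEquiv k (kerTotal k A)).symm
      ((quotKerTotalEquiv k A).symm (Finsupp.linearCombination A (D k A) f))) = _
  rw [h]
  rfl

theorem lieDer_D (E : Derivation k A A) (y : A) : lieDer E (D k A y) = D k A (E y) := by
  have h := lieDer_linearCombination E (Finsupp.single y 1)
  simpa [lieDerAux_single] using h

theorem lieDer_smul (E : Derivation k A A) (a : A) (ω : Ω[A⁄k]) :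
    lieDer E (a • ω) = E a • ω + a • lieDer E ω := by
  obtain ⟨f, rfl⟩ := linearCombination_surjective k A ω
  rw [← map_smul, lieDer_linearCombination, lieDerAux_smul, lieDer_linearCombination]

theorem lieDer_add_left (E E' : Derivation k A A) (ω : Ω[A⁄k]) :
    lieDer (E + E') ω = lieDer E ω + lieDer E' ω := by
  induction ω using span_induction_D with
  | hD x => simp [lieDer_D]
  | h0 => simp
  | ha x y hx hy => simp only [map_add, hx, hy]; abel
  | hs a x hx => simp only [lieDer_smul, hx, Derivation.add_apply, add_smul, smul_add]; abel

/-- The last term is Cartan's correction: on an exact form it comes from `d(c E(x)) = c d(E(x)) +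
E(x) dc`. -/
theorem lieDer_smul_left (c : A) (E : Derivation k A A) (ω : Ω[A⁄k]) :
    lieDer (c • E) ω = c • lieDer E ω + E.liftKaehlerDifferential ω • D k A c := by
  induction ω using span_induction_D with
  | hD x => simp [lieDer_D]
  | h0 => simp
  | ha x y hx hy => simp only [map_add, hx, hy, smul_add, add_smul]; abel
  | hs a x hx =>
    simp only [lieDer_smul, hx, Derivation.smul_apply, smul_add, map_smul, smul_smul, smul_eq_mul,
      mul_comm a c]
    abel

theorem lieDer_smul_left' (c : k) (E : Derivation k A A) (ω : Ω[A⁄k]) :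
    lieDer (c • E) ω = c • lieDer E ω := by
  have h := lieDer_smul_left (algebraMap k A c) E ω
  rwa [Derivation.map_algebraMap, smul_zero, add_zero, algebraMap_smul, algebraMap_smul] at h

end LieDerivative

end KaehlerDifferential

/-! ### The cotangent Lie-Rinehart algebra and its Koszul bracket. -/

namespace PoissonAlgebra

open KaehlerDifferential

section Cotangent

variable {k : Type u} {A : Type v} [Field k] [CommRing A] [Algebra k A] [PoissonAlgebra k A]

theorem bracket_skew (x y : A) : bracket (k := k) x y = - bracket (k := k) y x := by
  have h := bracket_self (k := k) (x + y)
  simp only [map_add, LinearMap.add_apply, bracket_self, zero_add, add_zero] at h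
  exact eq_neg_of_add_eq_zero_right h

/-- The Hamiltonian derivation `{x, ·}`. -/
noncomputable def ham (x : A) : Derivation k A A :=
  Derivation.mk' (bracket (k := k) x) fun a b => by
    rw [leibniz, smul_eq_mul, smul_eq_mul, add_comm, mul_comm b]

theorem ham_apply (x a : A) : ham (k := k) x a = bracket (k := k) x a := rfl

variable (k A) in
/-- The derivation `x ↦ {x, ·}`. -/
noncomputable def hamDer : Derivation k A (Derivation k A A) :=
  Derivation.mk'
    { toFun := ham
      map_add' := fun x y => by ext a; simp [ham_apply]
      map_smul' := fun c x => by ext a; simp [ham_apply] }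
    fun x y => by
      ext a
      change bracket (k := k) (x * y) a = x * bracket (k := k) y a + y * bracket (k := k) x a
      rw [bracket_skew, leibniz, bracket_skew a x, bracket_skew a y]
      ring

variable (k A) in
/-- The anchor of the cotangent Lie-Rinehart algebra. -/
noncomputable def anchor : Ω[A⁄k] →ₗ[A] Derivation k A A := (hamDer k A).liftKaehlerDifferential

theorem anchor_D (x a : A) : anchor k A (D k A x) a = bracket (k := k) x a := by
  rw [anchor, Derivation.liftKaehlerDifferential_comp_D]
  rfl

/-- The pairing of forms given by the Poisson bivector. -/
noncomputable def pair (α β : Ω[A⁄k]) : A := (anchor k A α).liftKaehlerDifferential β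

theorem pair_D (α : Ω[A⁄k]) (x : A) : pair α (D k A x) = anchor k A α x :=
  Derivation.liftKaehlerDifferential_comp_D _ _

theorem pair_add (α β γ : Ω[A⁄k]) : pair α (β + γ) = pair α β + pair α γ := map_add _ _ _

theorem pair_smul (α β : Ω[A⁄k]) (a : A) : pair α (a • β) = a * pair α β := map_smul _ _ _

theorem add_pair (α β γ : Ω[A⁄k]) : pair (α + β) γ = pair α γ + pair β γ := by
  induction γ using span_induction_D with
  | hD x => simp [pair_D]
  | h0 => simp [pair]
  | ha x y hx hy => simp only [pair_add, hx, hy]; abel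
  | hs a x hx => simp only [pair_smul, hx, mul_add]

theorem smul_pair (a : A) (α γ : Ω[A⁄k]) : pair (a • α) γ = a * pair α γ := by
  induction γ using span_induction_D with
  | hD x => simp [pair_D]
  | h0 => simp [pair]
  | ha x y hx hy => simp only [pair_add, hx, hy, mul_add]
  | hs a x hx => simp only [pair_smul, hx, mul_left_comm]

theorem pair_skew (α β : Ω[A⁄k]) : pair α β = - pair β α := by
  have h0 : ∀ γ : Ω[A⁄k], pair 0 γ = 0 := fun γ => by simpa using smul_pair 0 0 γ
  have h0' : ∀ γ : Ω[A⁄k], pair γ 0 = 0 := fun γ => map_zero _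
  induction β using span_induction_D with
  | hD y =>
    induction α using span_induction_D with
    | hD x => rw [pair_D, pair_D, anchor_D, anchor_D, bracket_skew]
    | h0 => simp [h0, h0']
    | ha x y hx hy => rw [add_pair, pair_add, hx, hy]; abel
    | hs a x hx => rw [smul_pair, pair_smul, hx, mul_neg]
  | h0 => simp [h0, h0']
  | ha x y hx hy => rw [add_pair, pair_add, hx, hy]; abel
  | hs a x hx => rw [smul_pair, pair_smul, hx, mul_neg]

/-- Skew-symmetry alone would not give this in characteristic two. It is checked on exact forms and
extended quadratically, the cross terms cancelling by `pair_skew`. -/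
theorem pair_self (α : Ω[A⁄k]) : pair α α = 0 := by
  induction α using span_induction_D with
  | hD x => rw [pair_D, anchor_D, bracket_self]
  | h0 => exact map_zero _
  | ha x y hx hy => rw [add_pair, pair_add, pair_add, hx, hy, pair_skew x y]; abel
  | hs a x hx => rw [smul_pair, pair_smul, hx, mul_zero, mul_zero]

variable (k A) in
/-- The Koszul bracket of differential forms. -/
noncomputable def koszul : Ω[A⁄k] →ₗ[k] Ω[A⁄k] →ₗ[k] Ω[A⁄k] :=
  LinearMap.mk₂ k (fun α β => lieDer (anchor k A α) β - lieDer (anchor k A β) α - D k A (pair α β))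
    (fun α β γ => by simp only [map_add, lieDer_add_left, add_pair]; abel)
    (fun c α β => by
      have h : anchor k A (c • α) = c • anchor k A α :=
        LinearMap.map_smul_of_tower _ _ _
      have h' : pair (c • α) β = c • pair α β := by
        rw [← algebraMap_smul A c α, smul_pair, Algebra.smul_def]
      rw [h, h', lieDer_smul_left', map_smul, Derivation.map_smul, smul_sub, smul_sub])
    (fun α β γ => by simp only [map_add, lieDer_add_left, pair_add]; abel)
    (fun c α β => by
      have h : anchor k A (c • β) = c • anchor k A β :=
        LinearMap.map_smul_of_tower _ _ _
      have h' : pair α (c • β) = c • pair α β := by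
        rw [← algebraMap_smul A c β, pair_smul, Algebra.smul_def]
      rw [h, h', lieDer_smul_left', map_smul, Derivation.map_smul, smul_sub, smul_sub])

theorem koszul_apply (α β : Ω[A⁄k]) : koszul k A α β =
    lieDer (anchor k A α) β - lieDer (anchor k A β) α - D k A (pair α β) := rfl

theorem koszul_self (α : Ω[A⁄k]) : koszul k A α α = 0 := by
  rw [koszul_apply, pair_self, sub_self, map_zero, sub_zero]

theorem koszul_skew (α β : Ω[A⁄k]) : koszul k A α β = - koszul k A β α := by
  rw [koszul_apply, koszul_apply, pair_skew, map_neg]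
  abel

theorem koszul_D (x y : A) : koszul k A (D k A x) (D k A y) = D k A (bracket (k := k) x y) := by
  rw [koszul_apply, lieDer_D, lieDer_D, pair_D, anchor_D, anchor_D, bracket_skew y x, map_neg]
  abel

/-- The Lie derivative along the anchor of `a • β` and the differential of `a * pair α β` each
produce a multiple of `da`; these cancel by skew-symmetry of the pairing. -/
theorem koszul_smul (α : Ω[A⁄k]) (a : A) (β : Ω[A⁄k]) :
    koszul k A α (a • β) = a • koszul k A α β + anchor k A α a • β := by
  have h : (anchor k A β).liftKaehlerDifferential α = pair β α := rfl
  rw [koszul_apply, koszul_apply, lieDer_smul, map_smul, lieDer_smul_left, pair_smul,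
    Derivation.leibniz, h, pair_skew α β, smul_sub, smul_sub, neg_smul]
  abel

theorem jacobi' (x y z : A) : bracket (k := k) x (bracket (k := k) y z) =
    bracket (k := k) (bracket (k := k) x y) z + bracket (k := k) y (bracket (k := k) x z) := by
  have h := jacobi (k := k) x y z
  rw [bracket_skew z x, map_neg, bracket_skew z (bracket (k := k) x y)] at h
  linear_combination h

/-- By the Leibniz rule for `koszul` the difference of the two sides is `A`-linear in `β`, hence
also in `α` by skew-symmetry. On exact forms it is the Poisson Jacobi identity. -/
theorem anchor_koszul (α β : Ω[A⁄k]) (a : A) : anchor k A (koszul k A α β) a =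
    anchor k A α (anchor k A β a) - anchor k A β (anchor k A α a) := by
  have key : ∀ (α β : Ω[A⁄k]), (∀ y, anchor k A (koszul k A α (D k A y)) a =
      anchor k A α (anchor k A (D k A y) a) - anchor k A (D k A y) (anchor k A α a)) →
      anchor k A (koszul k A α β) a =
        anchor k A α (anchor k A β a) - anchor k A β (anchor k A α a) := by
    intro α β h
    induction β using span_induction_D with
    | hD y => exact h y
    | h0 => simp
    | ha x y hx hy => simp only [map_add, Derivation.add_apply, hx, hy]; abel
    | hs c x hx =>
      simp only [koszul_smul, map_add, map_smul, Derivation.add_apply, Derivation.smul_apply, hx,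
        smul_eq_mul, Derivation.leibniz]
      ring
  refine key α β fun y => ?_
  rw [koszul_skew, map_neg, Derivation.neg_apply, key (D k A y) α fun x => ?_]
  · abel
  · simp only [koszul_D, anchor_D]
    rw [jacobi' y x a]
    abel

/-- The Jacobi defect is `A`-linear in its last argument, thanks to `anchor_koszul`. Since the
identity is stable under permuting the arguments, each in turn can be moved to the last place and
made exact. -/
theorem koszul_jacobi (α β γ : Ω[A⁄k]) : koszul k A α (koszul k A β γ) =
    koszul k A (koszul k A α β) γ + koszul k A β (koszul k A α γ) := by
  have key : ∀ (α β γ : Ω[A⁄k]), (∀ z, koszul k A α (koszul k A β (D k A z)) =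
      koszul k A (koszul k A α β) (D k A z) + koszul k A β (koszul k A α (D k A z))) →
      koszul k A α (koszul k A β γ) =
        koszul k A (koszul k A α β) γ + koszul k A β (koszul k A α γ) := by
    intro α β γ h
    induction γ using span_induction_D with
    | hD y => exact h y
    | h0 => simp
    | ha x y hx hy => simp only [map_add, hx, hy]; abel
    | hs c x hx =>
      simp only [koszul_smul, map_add, hx, anchor_koszul, sub_smul, smul_add]
      abel
  have swap : ∀ α β γ : Ω[A⁄k], koszul k A α (koszul k A β γ) =
      koszul k A (koszul k A α β) γ + koszul k A β (koszul k A α γ) →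
      koszul k A α (koszul k A γ β) =
        koszul k A (koszul k A α γ) β + koszul k A γ (koszul k A α β) := by
    intro α β γ h
    rw [koszul_skew γ β, map_neg, h, koszul_skew (koszul k A α γ) β, koszul_skew γ (koszul k A α β)]
    abel
  have swap' : ∀ α β γ : Ω[A⁄k], koszul k A α (koszul k A β γ) =
      koszul k A (koszul k A α β) γ + koszul k A β (koszul k A α γ) →
      koszul k A β (koszul k A α γ) =
        koszul k A (koszul k A β α) γ + koszul k A α (koszul k A β γ) := by
    intro α β γ h
    rw [h, koszul_skew β α, map_neg, LinearMap.neg_apply]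
    abel
  refine key α β γ fun z => swap _ _ _ (key _ _ _ fun y => swap' _ _ _ (swap _ _ _
    (key _ _ _ fun x => ?_)))
  simp only [koszul_D]
  rw [jacobi', map_add]

variable (k A) in
/-- The cotangent Lie-Rinehart algebra of a Poisson algebra. -/
noncomputable def cotangent : LieRinehart k A (Ω[A⁄k]) where
  anchor := anchor k A
  br := koszul k A
  br_self := koszul_self
  jacobi := koszul_jacobi
  br_smul := koszul_smul
  anchor_br := anchor_koszul

end Cotangent

end PoissonAlgebra

/-! ### From projective to free: the swindle and the flat semidirect product. -/

/-- An instance of the Eilenberg swindle: a projective module becomes free after adding a suitable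
free module. -/
theorem Module.Projective.free_prod_finsupp (A P : Type*) [CommRing A] [AddCommGroup P]
    [Module A P] [Module.Projective A P] : Module.Free A (P × (ℕ × P →₀ A)) := by
  obtain ⟨s, hs⟩ := (Module.projective_def' (R := A) (P := P)).1 inferInstance
  set π : (P →₀ A) →ₗ[A] P := Finsupp.linearCombination A id
  have hs' : ∀ p, π (s p) = p := fun p => LinearMap.congr_fun hs p
  -- The idempotent `s ∘ π` splits each copy of `P →₀ A` into a part isomorphic to `P` and a
  -- complement. `T` fixes the complements and shifts the `P`-parts up by one copy, the extra
  -- summand `P` filling the place freed in copy `0`. `T'` shifts back down, sending the `P`-part of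
  -- copy `0` out to `P`.
  let T : P × (ℕ →₀ P →₀ A) →ₗ[A] (ℕ →₀ P →₀ A) :=
    (Finsupp.lsingle 0 ∘ₗ s).coprod (Finsupp.lsum A fun n =>
      Finsupp.lsingle n ∘ₗ (LinearMap.id - s ∘ₗ π) + Finsupp.lsingle (n + 1) ∘ₗ s ∘ₗ π)
  let T' : (ℕ →₀ P →₀ A) →ₗ[A] P × (ℕ →₀ P →₀ A) :=
    Finsupp.lsum A fun n => LinearMap.prod (if n = 0 then π else 0)
      (Finsupp.lsingle n ∘ₗ (LinearMap.id - s ∘ₗ π) +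
        (if n = 0 then 0 else Finsupp.lsingle (n - 1) ∘ₗ s ∘ₗ π))
  have hT0 : ∀ p, T (p, 0) = Finsupp.single 0 (s p) := fun p => by simp [T]
  have hT : ∀ n v, T (0, Finsupp.single n v) =
      Finsupp.single n (v - s (π v)) + Finsupp.single (n + 1) (s (π v)) := fun n v => by
    simp [T]
  have hT'0 : ∀ v, T' (Finsupp.single 0 v) = (π v, Finsupp.single 0 (v - s (π v))) :=
    fun v => by simp [T']
  have hT' : ∀ n v, T' (Finsupp.single (n + 1) v) =
      (0, Finsupp.single (n + 1) (v - s (π v)) + Finsupp.single n (s (π v))) :=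
    fun n v => by simp [T']
  have h1 : T' ∘ₗ T = LinearMap.id := by
    refine LinearMap.prod_ext (LinearMap.ext fun p => ?_) (Finsupp.lhom_ext fun n v => ?_)
    · change T' (T (p, 0)) = (p, 0)
      rw [hT0, hT'0, hs', sub_self, Finsupp.single_zero]
    · change T' (T (0, Finsupp.single n v)) = (0, Finsupp.single n v)
      rw [hT, map_add, hT']
      cases n with
      | zero => rw [hT'0]; simp [hs']; abel
      | succ n => rw [hT']; simp [hs']; abel
  have h2 : T ∘ₗ T' = LinearMap.id := by
    refine Finsupp.lhom_ext fun n v => ?_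
    change T (T' (Finsupp.single n v)) = Finsupp.single n v
    have e : ∀ p w, T (p, w) = T (p, 0) + T (0, w) := fun p w => by
      rw [← map_add, Prod.mk_add_mk, add_zero, zero_add]
    have e' : ∀ w w', T (0, w + w') = T (0, w) + T (0, w') := fun p w => by
      rw [← map_add, Prod.mk_add_mk, add_zero]
    cases n with
    | zero => rw [hT'0, e, hT0, hT]; simp [hs']; abel
    | succ n => rw [hT', e', hT, hT]; simp [hs']; abel
  exact Module.Free.of_equiv
    ((LinearEquiv.refl A P).prodCongr (Finsupp.curryLinearEquiv A) ≪≫ₗ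
      LinearEquiv.ofLinearMap T T' h2 h1).symm

namespace LieRinehart

variable {k A L : Type*} [CommRing k] [CommRing A] [Algebra k A]
  [AddCommGroup L] [Module k L] [Module A L] [IsScalarTower k A L]

/-- A derivation of `A` acts coefficientwise on a free module. -/
noncomputable def flat (κ : Type*) (D : Derivation k A A) : (κ →₀ A) →ₗ[k] (κ →₀ A) :=
  Finsupp.mapRange.linearMap D.toLinearMap

theorem flat_apply {κ : Type*} (D : Derivation k A A) (v : κ →₀ A) (j : κ) :
    flat κ D v j = D (v j) := rfl

/-- The semidirect product of a Lie-Rinehart algebra and a free module with its coefficientwise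
flat connection. -/
noncomputable def semidirect (S : LieRinehart k A L) (κ : Type*) :
    LieRinehart k A (L × (κ →₀ A)) where
  anchor := S.anchor ∘ₗ LinearMap.fst A L (κ →₀ A)
  br := LinearMap.mk₂ k
    (fun x y => (S.br x.1 y.1, flat κ (S.anchor x.1) y.2 - flat κ (S.anchor y.1) x.2))
    (fun x y z => by
      refine Prod.ext (by simp) (Finsupp.ext fun j => ?_)
      simp [flat_apply]; abel)
    (fun c x y => by
      refine Prod.ext (by simp) (Finsupp.ext fun j => ?_)
      have h : S.anchor (c • x.1) = c • S.anchor x.1 := LinearMap.map_smul_of_tower _ _ _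
      simp [flat_apply, h, smul_sub])
    (fun x y z => by
      refine Prod.ext (by simp) (Finsupp.ext fun j => ?_)
      simp [flat_apply]; abel)
    (fun c x y => by
      refine Prod.ext (by simp) (Finsupp.ext fun j => ?_)
      have h : S.anchor (c • y.1) = c • S.anchor y.1 := LinearMap.map_smul_of_tower _ _ _
      simp [flat_apply, h, smul_sub])
  br_self x := Prod.ext (S.br_self _) (sub_self _)
  jacobi x y z := by
    refine Prod.ext (S.jacobi _ _ _) (Finsupp.ext fun j => ?_)
    simp [flat_apply, S.anchor_br]
    abel
  br_smul x a y := by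
    refine Prod.ext (S.br_smul _ _ _) (Finsupp.ext fun j => ?_)
    simp [flat_apply]
    ring
  anchor_br x y a := S.anchor_br _ _ _

theorem semidirect_br_inl (S : LieRinehart k A L) (κ : Type*) (x y : L) :
    (S.semidirect κ).br (x, 0) (y, 0) = (S.br x y, 0) :=
  Prod.ext rfl (by
    change flat κ (S.anchor x) 0 - flat κ (S.anchor y) 0 = 0
    simp)

theorem semidirect_anchor (S : LieRinehart k A L) (κ : Type*) (x : L) (u : κ →₀ A) :
    (S.semidirect κ).anchor (x, u) = S.anchor x := rfl

end LieRinehart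

/-! ### Leading terms of the action. -/

namespace LieRinehart

open MvPolynomial Module

variable {k A L ι : Type*} [CommRing k] [CommRing A] [Algebra k A]
  [AddCommGroup L] [Module k L] [Module A L]

theorem homogeneousComponent_mon (n : ℕ) (J : ι →₀ ℕ) :
    homogeneousComponent n (mon A J) = if J.degree = n then mon A J else 0 := by
  have h : mon A J ∈ homogeneousSubmodule ι A J.degree := isHomogeneous_monomial 1 rfl
  rw [homogeneousComponent_of_mem h]
  simp only [eq_comm]

theorem homogeneousComponent_eq_zero_of_mem_fil {m n : ℕ} (h : m < n) {w : MvPolynomial ι A}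
    (hw : w ∈ fil ι A m) : homogeneousComponent n w = 0 := by
  induction hw using Submodule.span_induction with
  | mem w h' =>
    obtain ⟨J, hJ, rfl⟩ := h'
    rw [homogeneousComponent_mon, if_neg (by omega)]
  | zero => simp
  | add x y _ _ hx hy => rw [map_add, hx, hy, add_zero]
  | smul c x _ hx => rw [map_smul, hx, smul_zero]

theorem homogeneousComponent_sym_mul (b : Basis ι A L) (n : ℕ) (l : L) (w : MvPolynomial ι A) :
    homogeneousComponent (n + 1) (sym b l * w) = sym b l * homogeneousComponent n w := by
  induction l using basis_span_induction b with
  | hb i =>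
    rw [sym_basis]
    induction w using mon_induction with
    | hm a J =>
      rw [mul_smul_comm, map_smul, map_smul, X_mul_mon, homogeneousComponent_mon,
        homogeneousComponent_mon, map_add, Finsupp.degree_single, add_comm 1, mul_smul_comm]
      simp only [Nat.add_right_cancel_iff]
      split_ifs
      · rw [X_mul_mon]
      · rw [mul_zero]
    | ha p q hp hq => simp only [mul_add, map_add, hp, hq]
  | h0 => simp
  | ha x y hx hy => simp only [map_add, add_mul, hx, hy]
  | hs a x hx => simp only [map_smul, smul_mul_assoc, hx]

variable [LinearOrder ι] (S : LieRinehart k A L) (b : Basis ι A L)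

/-- The action differs from multiplication by terms of degree at most `n`, invisible in degree `n +
1`. -/
theorem homogeneousComponent_act (l : L) {n : ℕ} {w : MvPolynomial ι A} (hw : w ∈ fil ι A n) :
    homogeneousComponent (n + 1) (act S b l w) = sym b l * homogeneousComponent n w := by
  have h := homogeneousComponent_eq_zero_of_mem_fil n.lt_succ_self (act_sub_sym_mem S b l hw)
  rwa [map_sub, homogeneousComponent_sym_mul, sub_eq_zero] at h

theorem act_smul_left_base [IsScalarTower k A L] (c : k) (l : L) (w : MvPolynomial ι A) :
    act S b (c • l) w = c • act S b l w := by
  rw [← algebraMap_smul A c l, act_smul_left, algebraMap_smul]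

end LieRinehart

/-! ### The polynomial representation of `A^e` and the principal symbol. -/

namespace PoissonAlgebra

open KaehlerDifferential MvPolynomial

variable {k : Type u} {A : Type v} [Field k] [CommRing A] [Algebra k A] [PoissonAlgebra k A]

namespace Env

section Lift

variable {B : Type*} [Ring B] [Algebra k B] (f : A →ₐ[k] B) (g : A →ₗ[k] B)
  (hg : ∀ x y, g (bracket (k := k) x y) = g x * g y - g y * g x)
  (hfg : ∀ x y, g (x * y) = f y * g x + f x * g y)
  (hf : ∀ x y, f (bracket (k := k) x y) = g x * f y - f y * g x)

/-- The universal property of the enveloping algebra. -/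
noncomputable def lift : Env k A →ₐ[k] B :=
  RingQuot.liftAlgHom k ⟨TensorAlgebra.lift k (f.toLinearMap.coprod g), fun {x y} h => by
    induction h with
    | m_mul x y => simp [genM]
    | h_bracket x y => simpa [genH] using hg x y
    | h_mul x y => simpa [genM, genH] using hfg x y
    | m_bracket x y => simpa [genM, genH] using hf x y
    | m_one => simp [genM]⟩

theorem lift_m (x : A) : lift f g hg hfg hf (m k A x) = f x := by
  change RingQuot.liftAlgHom k _ (RingQuot.mkAlgHom k _ (TensorAlgebra.ι k (x, 0))) = _
  simp

theorem lift_h (x : A) : lift f g hg hfg hf (h k A x) = g x := by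
  change RingQuot.liftAlgHom k _ (RingQuot.mkAlgHom k _ (TensorAlgebra.ι k (0, x))) = _
  simp

end Lift

section Representation

variable {κ ι : Type*} [LinearOrder ι] (b : Module.Basis ι A (Ω[A⁄k] × (κ →₀ A)))

/-- The action of `A^e` on polynomials obtained from a basis of `Ω_A × A^κ`. -/
noncomputable def rep : Env k A →ₐ[k] Module.End k (MvPolynomial ι A) :=
  lift (Algebra.lsmul k k (MvPolynomial ι A))
    { toFun := fun x => LieRinehart.act ((cotangent k A).semidirect κ) b (D k A x, 0)
      map_add' := fun x y => LinearMap.ext fun w => by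
        rw [LinearMap.add_apply, ← LieRinehart.act_add_left, Prod.mk_add_mk, add_zero, map_add]
      map_smul' := fun c x => LinearMap.ext fun w => by
        rw [RingHom.id_apply, LinearMap.smul_apply, ← LieRinehart.act_smul_left_base, Prod.smul_mk,
          smul_zero, Derivation.map_smul] }
    -- The three relations to check are, in order, the commutator identity `act_comm` on exact
    -- forms, the Leibniz rule of the universal derivation, and the twisted linearity of `act` with
    -- `{x, ·}` as anchor.
    (fun x y => LinearMap.ext fun w => by
      have h := LieRinehart.act_comm (S := (cotangent k A).semidirect κ) (b := b)
        (D k A x, 0) (D k A y, 0) w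
      rw [LieRinehart.semidirect_br_inl] at h
      have e : (cotangent k A).br (D k A x) (D k A y) = D k A (bracket (k := k) x y) :=
        koszul_D x y
      rw [e] at h
      exact h.symm)
    (fun x y => LinearMap.ext fun w => by
      change LieRinehart.act ((cotangent k A).semidirect κ) b (D k A (x * y), 0) w =
        y • LieRinehart.act ((cotangent k A).semidirect κ) b (D k A x, 0) w +
        x • LieRinehart.act ((cotangent k A).semidirect κ) b (D k A y, 0) w
      rw [← LieRinehart.act_smul_left, ← LieRinehart.act_smul_left, ← LieRinehart.act_add_left,
        Derivation.leibniz, Prod.smul_mk, Prod.smul_mk, Prod.mk_add_mk, smul_zero, smul_zero,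
        add_zero, add_comm])
    (fun x y => LinearMap.ext fun w => by
      change bracket (k := k) x y • w =
        LieRinehart.act ((cotangent k A).semidirect κ) b (D k A x, 0) (y • w) -
        y • LieRinehart.act ((cotangent k A).semidirect κ) b (D k A x, 0) w
      rw [LieRinehart.act_smul, add_sub_cancel_right, LieRinehart.semidirect_anchor]
      exact congrArg (· • w) (anchor_D x y).symm)

theorem rep_m (a : A) (w : MvPolynomial ι A) : rep b (m k A a) w = a • w := by
  rw [rep, lift_m]
  rfl

theorem rep_θ (ω : Ω[A⁄k]) (w : MvPolynomial ι A) :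
    rep b (θ k A ω) w = LieRinehart.act ((cotangent k A).semidirect κ) b (ω, 0) w := by
  induction ω using span_induction_D with
  | hD x => rw [θ_D, rep, lift_h]; rfl
  | h0 =>
    rw [map_zero, map_zero, LinearMap.zero_apply]
    exact (LieRinehart.op_zero_left _ _ _ _).symm
  | ha x y hx hy =>
    rw [map_add, map_add, LinearMap.add_apply, hx, hy, ← LieRinehart.act_add_left, Prod.mk_add_mk,
      add_zero]
  | hs a x hx =>
    rw [map_smul, smul_eq, map_mul, Module.End.mul_apply, rep_m, hx, ← LieRinehart.act_smul_left,
      Prod.smul_mk, smul_zero]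

/-- The action on the polynomial `1`. -/
noncomputable def evalOne : Env k A →ₗ[A] MvPolynomial ι A where
  toFun u := rep b u 1
  map_add' u w := by rw [map_add, LinearMap.add_apply]
  map_smul' a u := by rw [smul_eq, map_mul, Module.End.mul_apply, rep_m]; rfl

theorem evalOne_one : evalOne b (1 : Env k A) = 1 :=
  LinearMap.congr_fun (map_one (rep b)) 1

theorem evalOne_θ_mul (ω : Ω[A⁄k]) (u : Env k A) : evalOne b (θ k A ω * u) =
    LieRinehart.act ((cotangent k A).semidirect κ) b (ω, 0) (evalOne b u) := by
  rw [← rep_θ]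
  exact LinearMap.congr_fun (map_mul (rep b) (θ k A ω) u) 1

theorem evalOne_prod_mem (l : List (Ω[A⁄k])) :
    evalOne b (l.map (θ k A)).prod ∈ LieRinehart.fil ι A l.length := by
  induction l with
  | nil =>
    rw [List.map_nil, List.prod_nil, evalOne_one]
    exact LieRinehart.mon_mem_fil (by simp)
  | cons ω l ih =>
    rw [List.map_cons, List.prod_cons, evalOne_θ_mul]
    exact LieRinehart.act_mem _ b _ ih

/-- Starting from `1`, each differential raises the degree by at most one and multiplies the top
part by its linear form. -/
theorem homogeneousComponent_evalOne_prod (l : List (Ω[A⁄k])) :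
    homogeneousComponent l.length (evalOne b (l.map (θ k A)).prod) =
      (l.map fun ω => LieRinehart.sym b (ω, 0)).prod := by
  induction l with
  | nil =>
    simp [evalOne_one]
  | cons ω l ih =>
    rw [List.map_cons, List.prod_cons, evalOne_θ_mul, List.length_cons,
      LieRinehart.homogeneousComponent_act _ b _ (evalOne_prod_mem b l), ih, List.map_cons, List.prod_cons]

theorem evalOne_mem {n : ℕ} {u : Env k A} (hu : u ∈ F k A n) :
    evalOne b u ∈ LieRinehart.fil ι A n := by
  induction hu using Submodule.span_induction with
  | mem u h =>
    obtain ⟨l, hl, rfl⟩ := h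
    exact LieRinehart.fil_mono hl (evalOne_prod_mem b l)
  | zero => simp
  | add x y _ _ hx hy => rw [map_add]; exact add_mem hx hy
  | smul c x _ hx => rw [map_smul]; exact Submodule.smul_mem _ c hx

/-- The principal symbol on the `n`-th graded piece. -/
noncomputable def symbol (n : ℕ) : GrPiece k A n →ₗ[A] MvPolynomial ι A :=
  Submodule.liftQ _ ((homogeneousComponent n ∘ₗ evalOne b).domRestrict (F k A n)) (by
    rintro ⟨u, hu⟩ h
    have h' : u ∈ Fpred k A n := h
    change homogeneousComponent n (evalOne b u) = 0
    cases n with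
    | zero => rw [(Submodule.mem_bot A).1 h', map_zero, map_zero]
    | succ n =>
      exact LieRinehart.homogeneousComponent_eq_zero_of_mem_fil n.lt_succ_self (evalOne_mem b h'))

theorem symbol_cls (n : ℕ) (u : Env k A) (hu : u ∈ F k A n) :
    symbol b n (cls n u hu) = homogeneousComponent n (evalOne b u) := rfl

/-- The principal symbol on the associated graded algebra. -/
noncomputable def grSymbol : Gr k A →ₗ[A] MvPolynomial ι A := DirectSum.toModule A ℕ _ (symbol b)

end Representation

end Env

end PoissonAlgebra

/-! ### Maps out of the symmetric algebra. -/

namespace SymmetricAlgebra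

variable {R M : Type*} [CommRing R] [AddCommGroup M] [Module R M]

/-- The symmetric algebra is spanned by the products of elements of the module. -/
theorem span_prod_ι_eq_top :
    Submodule.span R {w | ∃ l : List M, (l.map (ι R M)).prod = w} = ⊤ := by
  refine eq_top_iff.2 fun a _ => ?_
  induction a using SymmetricAlgebra.induction with
  | algebraMap r =>
    rw [Algebra.algebraMap_eq_smul_one]
    exact Submodule.smul_mem _ r (Submodule.subset_span ⟨[], rfl⟩)
  | ι x => exact Submodule.subset_span ⟨[x], by simp⟩
  | add a b ha hb => exact add_mem (ha trivial) (hb trivial)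
  | mul a b ha hb =>
    have h := Submodule.mul_mem_mul (ha trivial) (hb trivial)
    rw [Submodule.span_mul_span] at h
    refine Submodule.span_mono ?_ h
    rintro _ ⟨_, ⟨l, rfl⟩, _, ⟨l', rfl⟩, rfl⟩
    exact ⟨l ++ l', by simp⟩

/-- The target need not be commutative; commuting values on generators are enough. This matters
because the associated graded algebra comes only with a ring structure. -/
theorem symRingCon_le_ker {B : Type*} [Ring B] [Algebra R B] (f : M →ₗ[R] B)
    (hf : ∀ x y, f x * f y = f y * f x) :
    TensorAlgebra.symRingCon R M ≤ RingCon.ker (TensorAlgebra.lift R f).toRingHom :=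
  RingCon.ringConGen_le.2 fun x y h => by
    induction h with
    | mul_comm x y => simp [RingCon.ker_apply, hf x y]

/-- Lift a linear map with commuting values to the symmetric algebra. -/
noncomputable def liftOfCommute {B : Type*} [Ring B] [Algebra R B] (f : M →ₗ[R] B)
    (hf : ∀ x y, f x * f y = f y * f x) : SymmetricAlgebra R M →ₐ[R] B :=
  RingCon.liftₐ _ (TensorAlgebra.lift R f) (symRingCon_le_ker f hf)

theorem liftOfCommute_ι {B : Type*} [Ring B] [Algebra R B] (f : M →ₗ[R] B)
    (hf : ∀ x y, f x * f y = f y * f x) (x : M) : liftOfCommute f hf (ι R M x) = f x :=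
  TensorAlgebra.lift_ι_apply f x

end SymmetricAlgebra

/-! ### The comparison map and its bijectivity. -/

namespace PoissonAlgebra

namespace Env

open KaehlerDifferential

variable {k : Type u} {A : Type v} [Field k] [CommRing A] [Algebra k A] [PoissonAlgebra k A]

/-- The images of two differentials commute up to `F_1`. -/
theorem θ_commutator_mem (α β : Ω[A⁄k]) : θ k A α * θ k A β - θ k A β * θ k A α ∈ F k A 1 := by
  have key : ∀ α β : Ω[A⁄k],
      (∀ y, θ k A α * θ k A (D k A y) - θ k A (D k A y) * θ k A α ∈ F k A 1) →
      θ k A α * θ k A β - θ k A β * θ k A α ∈ F k A 1 := by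
    intro α β h
    induction β using span_induction_D with
    | hD y => exact h y
    | h0 => simp
    | ha x y hx hy =>
      rw [map_add, mul_add, add_mul, add_sub_add_comm]
      exact add_mem hx hy
    -- Moving `c` past `θ α` costs an element of `m_A`, whose product with `θ x` is still in `F_1`.
    | hs c x hx =>
      obtain ⟨d, hd⟩ := θ_comm α c
      have e : θ k A α * θ k A (c • x) - θ k A (c • x) * θ k A α =
          c • (θ k A α * θ k A x - θ k A x * θ k A α) + d • θ k A x := by
        rw [map_smul, smul_eq, smul_eq, smul_eq, ← mul_assoc, hd, add_mul, mul_sub, mul_assoc,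
          mul_assoc]
        abel
      rw [e]
      exact add_mem (Submodule.smul_mem _ _ hx) (Submodule.smul_mem _ _ (θ_mem_F x))
  refine key α β fun y => ?_
  rw [← neg_sub]
  refine neg_mem (key _ _ fun x => ?_)
  have h : h k A (bracket (k := k) y x) = h k A y * h k A x - h k A x * h k A y :=
    (Env.mk_rel (EnvRel.h_bracket y x)).trans (by rw [map_sub, map_mul, map_mul]; rfl)
  rw [θ_D, θ_D, ← h]
  exact h_mem_F _

variable (k A) in
/-- The map `Ω_A → F_1 / F_0` into the associated graded algebra. -/
noncomputable def grθ : Ω[A⁄k] →ₗ[A] Gr k A :=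
  DirectSum.lof A ℕ (GrPiece k A) 1 ∘ₗ
    { toFun := fun ω => cls 1 (θ k A ω) (θ_mem_F ω)
      map_add' := fun x y => by
        rw [cls_add]; exact cls_eq_iff.2 (by simp)
      map_smul' := fun a x => by
        rw [RingHom.id_apply, cls_smul]; exact cls_eq_iff.2 (by simp [smul_eq]) }

theorem grθ_apply (ω : Ω[A⁄k]) :
    grθ k A ω = DirectSum.of (GrPiece k A) 1 (cls 1 (θ k A ω) (θ_mem_F ω)) := rfl

theorem of_cls_mul_of_cls {i j : ℕ} (u w : Env k A) (hu : u ∈ F k A i) (hw : w ∈ F k A j) :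
    DirectSum.of (GrPiece k A) i (cls i u hu) * DirectSum.of (GrPiece k A) j (cls j w hw) =
      DirectSum.of (GrPiece k A) (i + j) (cls (i + j) (u * w) (F_mul hu hw)) :=
  DirectSum.of_mul_of _ _

theorem grθ_comm (α β : Ω[A⁄k]) : grθ k A α * grθ k A β = grθ k A β * grθ k A α := by
  rw [grθ_apply, grθ_apply, of_cls_mul_of_cls, of_cls_mul_of_cls]
  exact congrArg _ (cls_eq_iff.2 (θ_commutator_mem α β))

variable (k A) in
/-- The canonical map from the symmetric algebra to the associated graded algebra. -/
noncomputable def symToGr : SymmetricAlgebra A (Ω[A⁄k]) →ₐ[A] Gr k A :=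
  SymmetricAlgebra.liftOfCommute (grθ k A) grθ_comm

theorem symToGr_ι (ω : Ω[A⁄k]) : symToGr k A (SymmetricAlgebra.ι A _ ω) = grθ k A ω :=
  SymmetricAlgebra.liftOfCommute_ι _ _ ω

theorem symToGr_prod (l : List (Ω[A⁄k])) :
    symToGr k A (l.map (SymmetricAlgebra.ι A (Ω[A⁄k]))).prod =
      DirectSum.of (GrPiece k A) l.length (cls l.length (l.map (θ k A)).prod (prod_mem_F l)) := by
  induction l with
  | nil => rw [List.map_nil, List.prod_nil, map_one]; rfl
  | cons ω l ih =>
    rw [List.map_cons, List.prod_cons, map_mul, ih, symToGr_ι, grθ_apply, of_cls_mul_of_cls]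
    exact DirectSum.of_eq_of_gradedMonoid_eq (mk_cls_eq (add_comm 1 l.length) (by simp) _ _)

/-- A product of exactly `n` differentials is the image of the corresponding symmetric product, and
a shorter one vanishes in `F_n / F_{n-1}`. -/
theorem symToGr_surjective : Function.Surjective (symToGr k A) := by
  have key : ∀ (n : ℕ) (u : Env k A) (hu : u ∈ F k A n),
      DirectSum.of (GrPiece k A) n (cls n u hu) ∈ LinearMap.range (symToGr k A).toLinearMap := by
    intro n u hu
    induction hu using Submodule.span_induction with
    | mem u h =>
      obtain ⟨l, hl, rfl⟩ := h
      rcases hl.eq_or_lt with rfl | hl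
      · exact ⟨_, symToGr_prod l⟩
      · have h0 : cls n (l.map (θ k A)).prod (F_mono hl.le (prod_mem_F l)) = 0 := by
          rw [← cls_zero]
          refine cls_eq_iff.2 ?_
          rw [sub_zero]
          obtain ⟨n, rfl⟩ : ∃ m, n = m + 1 := ⟨n - 1, by omega⟩
          exact F_mono (Nat.lt_succ_iff.1 hl) (prod_mem_F l)
        have h0' := congrArg (DirectSum.of (GrPiece k A) n) h0
        rw [map_zero] at h0'
        exact h0' ▸ zero_mem _
    | zero =>
      have h0' := congrArg (DirectSum.of (GrPiece k A) n) (cls_zero n)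
      rw [map_zero] at h0'
      exact h0' ▸ zero_mem _
    | add x y hx' hy' hx hy =>
      have h := add_mem hx hy
      rw [← map_add] at h
      exact h
    | smul c x hx' hx =>
      have h := Submodule.smul_mem _ c hx
      have e : c • DirectSum.of (GrPiece k A) n (cls n x hx') =
          DirectSum.of (GrPiece k A) n (c • cls n x hx') :=
        ((DirectSum.lof A ℕ (GrPiece k A) n).map_smul c _).symm
      rw [e] at h
      exact h
  intro x
  change x ∈ LinearMap.range (symToGr k A).toLinearMap
  induction x using DirectSum.induction_on with
  | zero => exact zero_mem _
  | of n x =>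
    induction x using cls_ind with
    | H u hu => exact key n u hu
  | add x y hx hy => exact add_mem hx hy

/-- On a product of differentials both sides are the product of the attached linear forms, and such
products span the symmetric algebra. -/
theorem grSymbol_symToGr {κ ι : Type*} [LinearOrder ι]
    (b : Module.Basis ι A (Ω[A⁄k] × (κ →₀ A))) (x : SymmetricAlgebra A (Ω[A⁄k])) :
    grSymbol b (symToGr k A x) =
      SymmetricAlgebra.lift (LieRinehart.sym b ∘ₗ LinearMap.inl A (Ω[A⁄k]) (κ →₀ A)) x := by
  have hx : x ∈ Submodule.span A
      {w | ∃ l : List (Ω[A⁄k]), (l.map (SymmetricAlgebra.ι A (Ω[A⁄k]))).prod = w} := by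
    rw [SymmetricAlgebra.span_prod_ι_eq_top]; trivial
  induction hx using Submodule.span_induction with
  | mem x h =>
    obtain ⟨l, rfl⟩ := h
    rw [symToGr_prod, map_list_prod, List.map_map]
    have e : grSymbol b (DirectSum.of (GrPiece k A) l.length
        (cls l.length (l.map (θ k A)).prod (prod_mem_F l))) =
        symbol b l.length (cls l.length (l.map (θ k A)).prod (prod_mem_F l)) :=
      DirectSum.toModule_lof A _ _
    rw [e, symbol_cls, homogeneousComponent_evalOne_prod]
    congr 2
    funext ω
    simp
  | zero => simp
  | add x y _ _ hx hy => rw [map_add, map_add, map_add, hx, hy]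
  | smul a x _ hx => rw [map_smul, map_smul, map_smul, hx]

/-- A left inverse comes from the projection `L × N → L`: send each variable to the `L`-component of
its basis vector. -/
theorem lift_sym_injective {L N ι : Type*} [AddCommGroup L] [Module A L] [AddCommGroup N]
    [Module A N] (b : Module.Basis ι A (L × N)) : Function.Injective
      (SymmetricAlgebra.lift (LieRinehart.sym b ∘ₗ LinearMap.inl A L N)) := by
  let r : MvPolynomial ι A →ₐ[A] SymmetricAlgebra A L :=
    MvPolynomial.aeval fun i => SymmetricAlgebra.ι A L (b i).1
  have hr : ∀ x, r (LieRinehart.sym b x) = SymmetricAlgebra.ι A L x.1 := fun x => by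
    induction x using LieRinehart.basis_span_induction b with
    | hb i => rw [LieRinehart.sym_basis, MvPolynomial.aeval_X]
    | h0 => simp
    | ha x y hx hy => rw [map_add, map_add, hx, hy, Prod.fst_add, map_add]
    | hs a x hx => rw [map_smul, map_smul, hx, Prod.smul_fst, map_smul]
  have h : r.comp (SymmetricAlgebra.lift (LieRinehart.sym b ∘ₗ LinearMap.inl A L N)) =
      AlgHom.id A _ := SymmetricAlgebra.algHom_ext (LinearMap.ext fun x => by simp [hr])
  exact Function.LeftInverse.injective (g := r) fun x => AlgHom.congr_fun h x

theorem symToGr_injective [Module.Projective A (Ω[A⁄k])] :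
    Function.Injective (symToGr k A) := by
  have := Module.Projective.free_prod_finsupp A (Ω[A⁄k])
  let b := Module.Free.chooseBasis A (Ω[A⁄k] × (ℕ × Ω[A⁄k] →₀ A))
  -- The normal ordering of monomials needs some linear order on the basis; any will do.
  let _ : LinearOrder (Module.Free.ChooseBasisIndex A (Ω[A⁄k] × (ℕ × Ω[A⁄k] →₀ A))) :=
    IsWellOrder.linearOrder WellOrderingRel
  refine Function.Injective.of_comp (f := grSymbol b) ?_
  rw [show grSymbol b ∘ symToGr k A = _ from funext (grSymbol_symToGr b)]
  exact lift_sym_injective b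

end Env

end PoissonAlgebra

theorem mainTheorem4 (k : Type u) (A : Type v) [Field k] [CommRing A] [Algebra k A]
    [PoissonAlgebra k A] [Module.Projective A (Ω[A⁄k])] :
    ∃ φ : SymmetricAlgebra A (Ω[A⁄k]) ≃ₐ[A] PoissonAlgebra.Env.Gr k A,
      ∀ x : A, φ (SymmetricAlgebra.ι A (Ω[A⁄k]) (KaehlerDifferential.D k A x)) =
        DirectSum.of (PoissonAlgebra.Env.GrPiece k A) 1
          (PoissonAlgebra.Env.cls 1 (PoissonAlgebra.Env.h k A x)
            (PoissonAlgebra.Env.h_mem_F x)) := by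
  refine ⟨AlgEquiv.ofBijective (PoissonAlgebra.Env.symToGr k A)
    ⟨PoissonAlgebra.Env.symToGr_injective, PoissonAlgebra.Env.symToGr_surjective⟩, fun x => ?_⟩
  refine (PoissonAlgebra.Env.symToGr_ι (KaehlerDifferential.D k A x)).trans ?_
  exact congrArg (DirectSum.of (PoissonAlgebra.Env.GrPiece k A) 1) (PoissonAlgebra.Env.cls_eq_iff.2
    (by rw [PoissonAlgebra.Env.θ_D, sub_self]; exact zero_mem _))
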